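/- **Setting.** A partition here has a fixed number of parts, and parts equal to $0$ are allowed and count as rows of length $0$. For a pair $(\lambda,\mu)$ of partitions and $N\ge 0$, the coinversion LLT polynomial in $X_N=\{x_1,\dots,x_N\}$ is $$\mathcal L_{(\lambda,\mu)}(X_N;t)=\sum_{(T,U)} t^{\mathrm{coinv}(T,U)}x^Tx^U\in\mathbb Z[t][x_1,\dots,x_N],$$ summed over pairs of semistandard Young tableaux $T$ of shape $\lambda$ and $U$ of shape $\mu$ with entries in $\{1,\dots,N\}$. Here $\mathrm{coinv}(T,U)$ is the number of pairs consisting of a cell $v=(i,j)$ of $\lambda$ (row $i$, column $j$) and a position $w=(r,c)$ with $1\le c\le \mu_r+1$ in some row $r$ of $\mu$ (rows of length $0$ included), such that $c-r=j-i$ and $U(r,c-1)\le T(v)\le U(r,c)$, where $U(r,0)=0$ and $U(r,\mu_r+1)=\infty$. Let $n\ge 0$ and let $\beta_1>\beta_2>\dots>\beta_{2n}\ge 0$ be integers. For each $n$-element subset $S=\{i_1<\dots<i_n\}$ of $\{1,\dots,2n\}$ with complement $\{j_1<\dots<j_n\}$, put $$\boldsymbol\beta_S=\bigl((\beta_{i_1}-n+1,\dots,\beta_{i_n}-n+n),\,(\beta_{j_1}-n+1,\dots,\beta_{j_n}-n+n)\bigr),$$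 a pair of partitions with $n$ parts each; these are $\binom{2n}{n}$ pairs. A non-crossing perfect matching of $1,\dots,2n$ is *compatible* with $S$ if each of its arcs joins an element of $S$ to an element not in $S$. **Theorem.** Let $C_n=\frac1{n+1}\binom{2n}{n}$. The non-crossing perfect matchings of $2n$ points can be listed as $M_1,\dots,M_{C_n}$, and there are integers $n_j(\boldsymbol\beta_S)$ such that for every $N$ there are polynomials $g_1,\dots,g_{C_n}\in\mathbb Z[t][x_1,\dots,x_N]$, symmetric in $x_1,\dots,x_N$ and not depending on $S$, with $$\mathcal L_{\boldsymbol\beta_S}(X_N;t)=\sum_{\substack{1\le j\le C_n\\ M_j\text{ compatible with }S}} t^{\,n_j(\boldsymbol\beta_S)}\,g_j(X_N;t)\quad\text{in }\mathbb Z[t,t^{-1}][x_1,\dots,x_N]$$ for every $n$-element subset $S$. -/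

import Mathlib

open scoped Polynomial LaurentPolynomial

noncomputable section

/-- A partition with a fixed number `m` of parts, where parts equal to zero are allowed
(and matter: they are counted as rows of length zero). -/
structure FixedPartition (m : ℕ) where
  parts : Fin m → ℕ
  antitone_parts : Antitone parts

/-- The cells of the Young diagram; rows and columns are indexed from `0`. -/
abbrev FixedPartition.Cell {m : ℕ} (lam : FixedPartition m) : Type :=
  Σ i : Fin m, Fin (lam.parts i)

/-- Semistandard fillings with entries in the alphabet `Fin N` (standing for `{1, …, N}`):
weakly increasing along rows, strictly increasing along columns. -/
def FixedPartition.IsSemistandard {m N : ℕ} (lam : FixedPartition m)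
    (T : lam.Cell → Fin N) : Prop :=
  (∀ (i : Fin m) (j j' : Fin (lam.parts i)), j ≤ j' → T ⟨i, j⟩ ≤ T ⟨i, j'⟩) ∧
  (∀ (i i' : Fin m) (j : ℕ) (hj : j < lam.parts i) (hj' : j < lam.parts i'),
    i < i' → T ⟨i, ⟨j, hj⟩⟩ < T ⟨i', ⟨j, hj'⟩⟩)

open Classical in
/-- The finite set of semistandard tableaux of shape `lam` with entries in `Fin N`. -/
def FixedPartition.ssyt {m : ℕ} (lam : FixedPartition m) (N : ℕ) :
    Finset (lam.Cell → Fin N) :=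
  Finset.univ.filter fun T => lam.IsSemistandard T

/-- The position of a triple `(u, v, w)` of the pair of straight shapes `(lam, mu)`:
`v` is a cell of the first shape, `w` is the position in row `row`, column `col` of the second
shape, on the same content line as `v`, and `u` is the position directly to the left of `w`.
Columns being counted from `0`, the range of `col` says that `w` is a cell of row `row` or the
position directly to the right of its end; `u` lies outside the shape iff `col = 0`. -/
structure LLTTriple {m m' : ℕ} (lam : FixedPartition m) (mu : FixedPartition m') where
  v : lam.Cell
  row : Fin m'
  col : Fin (mu.parts row + 1)
  content_eq : ((col : ℕ) : ℤ) - ((row : ℕ) : ℤ) = ((v.2 : ℕ) : ℤ) - ((v.1 : ℕ) : ℤ)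

/-- The triple is a coinversion triple, `a ≤ b ≤ c`, where the entry `a` of `u` is `0` and the
entry `c` of `w` is `∞` when the respective position is outside the shape. -/
def LLTTriple.IsCoinversion {m m' N : ℕ} {lam : FixedPartition m} {mu : FixedPartition m'}
    (τ : LLTTriple lam mu) (T : lam.Cell → Fin N) (U : mu.Cell → Fin N) : Prop :=
  (∀ (c : ℕ) (hc : c < mu.parts τ.row), (τ.col : ℕ) = c + 1 → U ⟨τ.row, ⟨c, hc⟩⟩ ≤ T τ.v) ∧
  (∀ hc : (τ.col : ℕ) < mu.parts τ.row, T τ.v ≤ U ⟨τ.row, ⟨τ.col, hc⟩⟩)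

/-- The number of coinversion triples of the pair of fillings `(T, U)`. -/
def coinv {m m' N : ℕ} {lam : FixedPartition m} {mu : FixedPartition m'}
    (T : lam.Cell → Fin N) (U : mu.Cell → Fin N) : ℕ :=
  Nat.card {τ : LLTTriple lam mu // τ.IsCoinversion T U}

/-- The coinversion LLT polynomial of the pair of straight shapes `(lam, mu)` in `N` variables,
as a polynomial in `x₁, …, x_N` with coefficients in `ℤ[t]`. -/
def LLT (N : ℕ) {m m' : ℕ} (lam : FixedPartition m) (mu : FixedPartition m') :
    MvPolynomial (Fin N) ℤ[X] :=
  ∑ T ∈ lam.ssyt N, ∑ U ∈ mu.ssyt N,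
    MvPolynomial.C (Polynomial.X ^ coinv T U) *
      ((∏ c : lam.Cell, MvPolynomial.X (T c)) * ∏ c : mu.Cell, MvPolynomial.X (U c))

/-- Extension of scalars from `ℤ[t]` to `ℤ[t, t⁻¹]`. -/
def toLaurentCoeffs (N : ℕ) :
    MvPolynomial (Fin N) ℤ[X] →+* MvPolynomial (Fin N) ℤ[T;T⁻¹] :=
  MvPolynomial.map Polynomial.toLaurent

/-- A choice of the `n` indices `i₁ < … < iₙ` among the `2n` available ones. -/
abbrev HalfSubset (n : ℕ) : Type := {S : Finset (Fin (2 * n)) // S.card = n}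

/-- The complementary indices `j₁ < … < jₙ`. -/
def HalfSubset.compl {n : ℕ} (S : HalfSubset n) : HalfSubset n :=
  ⟨S.1ᶜ, by rw [Finset.card_compl, Fintype.card_fin, S.2]; omega⟩

theorem famPart_aux {n : ℕ} (β : Fin (2 * n) → ℕ) (hβ : StrictAnti β) (S : HalfSubset n) :
    Antitone fun k : Fin n => β (S.1.orderEmbOfFin S.2 k) + (k + 1) - n := by
  cases n with
  | zero => intro a; exact a.elim0
  | succ n =>
    refine Fin.antitone_iff_succ_le.2 fun k => ?_
    have h : β (S.1.orderEmbOfFin S.2 k.succ) < β (S.1.orderEmbOfFin S.2 k.castSucc) :=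
      hβ ((S.1.orderEmbOfFin S.2).strictMono Fin.castSucc_lt_succ)
    simp only [Fin.val_succ, Fin.val_castSucc]
    omega

/-- The partition `(β_{i₁} - n + 1, …, β_{iₙ} - n + n)` for the index set
`S = {i₁ < … < iₙ}`. As `β_{i_k} ≥ n - k`, the subtraction never truncates. -/
def famPart {n : ℕ} (β : Fin (2 * n) → ℕ) (hβ : StrictAnti β) (S : HalfSubset n) :
    FixedPartition n where
  parts k := β (S.1.orderEmbOfFin S.2 k) + (k + 1) - n
  antitone_parts := famPart_aux β hβ S

/-- A non-crossing perfect matching of `2n` points on a line: every point `i` is joined by an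
arc to `partner i`, and no two arcs `{i, partner i}`, `{j, partner j}` satisfy
`i < j < partner i < partner j`. -/
@[ext]
structure NoncrossingMatching (n : ℕ) where
  partner : Fin (2 * n) → Fin (2 * n)
  partner_partner : ∀ i, partner (partner i) = i
  partner_ne : ∀ i, partner i ≠ i
  noncrossing : ∀ i j, i < j → j < partner i → ¬ partner i < partner j

/-- The matching is compatible with the coloring of the points by membership in `S`:
every arc joins points of different colors. -/
def NoncrossingMatching.Compatible {n : ℕ} (M : NoncrossingMatching n) (S : HalfSubset n) :
    Prop :=
  ∀ i, M.partner i ∈ S.1 ↔ i ∉ S.1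

instance {n : ℕ} (M : NoncrossingMatching n) (S : HalfSubset n) :
    Decidable (M.Compatible S) := by
  unfold NoncrossingMatching.Compatible
  infer_instance

end

section MatrixProductOperators

open Matrix Kronecker

variable {A : Type*} [CommRing A] {Q B C : Type*} [Fintype B] [DecidableEq B]
  [Fintype C] [DecidableEq C]

/-- The matrix product operator with local tensors `θ`, as a matrix in the bond space. -/
def mpo (θ : Q → Q → Matrix B B A) {K : ℕ} (S S' : Fin K → Q) : Matrix B B A :=
  (List.ofFn fun p => θ (S p) (S' p)).prod

theorem mpo_cons (θ : Q → Q → Matrix B B A) {K : ℕ} (s s' : Q) (S S' : Fin K → Q) :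
    mpo θ (Fin.cons s S : Fin (K + 1) → Q) (Fin.cons s' S' : Fin (K + 1) → Q) =
      θ s s' * mpo θ S S' := by
  simp [mpo, List.ofFn_succ]

theorem sum_fin_cons [Fintype Q] {M : Type*} [AddCommMonoid M] {K : ℕ}
    (f : (Fin (K + 1) → Q) → M) :
    ∑ S, f S = ∑ s, ∑ S, f (Fin.cons s S) := by
  rw [← (Fin.consEquiv fun _ => Q).sum_comp, Fintype.sum_prod_type]
  rfl

theorem sum_kronecker_prod [Fintype Q] : ∀ {K : ℕ} (a : Fin K → Q → Matrix B B A)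
    (b : Fin K → Q → Matrix C C A),
    ∑ S : Fin K → Q, (List.ofFn fun p => a p (S p)).prod ⊗ₖ (List.ofFn fun p => b p (S p)).prod =
      (List.ofFn fun p => ∑ m, a p m ⊗ₖ b p m).prod
  | 0, a, b => by simp
  | K + 1, a, b => by
    rw [sum_fin_cons, List.ofFn_succ, List.prod_cons,
      ← sum_kronecker_prod (fun p => a p.succ) (fun p => b p.succ), Finset.sum_mul_sum]
    simp [List.ofFn_succ, mul_kronecker_mul]

theorem mul_list_prod_eq {R : Matrix B B A} : ∀ {K : ℕ} {a b : Fin K → Matrix B B A},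
    (∀ p, R * a p = b p * R) → R * (List.ofFn a).prod = (List.ofFn b).prod * R
  | 0, a, b, _ => by simp
  | K + 1, a, b, h => by
    rw [List.ofFn_succ, List.ofFn_succ, List.prod_cons, List.prod_cons, ← mul_assoc, h 0,
      mul_assoc, mul_list_prod_eq (fun p => h p.succ), mul_assoc]

/-- If an intertwiner exchanges the local tensors of two matrix product operators, then the
operators commute, up to the corner entry of the intertwiner. -/
theorem mpo_commute [Fintype Q] (θ : Q → Q → Matrix B B A) (ξ : Q → Q → Matrix C C A)
    (R : Matrix (B × C) (B × C) A) {i i' : B} {c c' : C} {r : A}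
    (hR : ∀ s s', R * (∑ m, θ s m ⊗ₖ ξ m s') = (∑ m, θ m s' ⊗ₖ ξ s m) * R)
    (hrow : ∀ k, R (i, c) k = if k = (i, c) then r else 0)
    (hcol : ∀ k, R k (i', c') = if k = (i', c') then r else 0)
    {K : ℕ} (S S' : Fin K → Q) :
    r * ∑ m, mpo θ S m i i' * mpo ξ m S' c c' = r * ∑ m, mpo ξ S m c c' * mpo θ m S' i i' := by
  have h := mul_list_prod_eq (R := R) (a := fun p => ∑ m, θ (S p) m ⊗ₖ ξ m (S' p))
    (b := fun p => ∑ m, θ m (S' p) ⊗ₖ ξ (S p) m) fun p => hR _ _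
  rw [← sum_kronecker_prod (fun p m => θ (S p) m) (fun p m => ξ m (S' p)),
    ← sum_kronecker_prod (fun p m => θ m (S' p)) (fun p m => ξ (S p) m)] at h
  have h' := congrFun (congrFun h (i, c)) (i', c')
  simp only [Matrix.mul_apply, hrow, hcol, ite_mul, mul_ite, zero_mul, mul_zero,
    Finset.sum_ite_eq', Finset.mem_univ, if_true, Matrix.sum_apply, kroneckerMap_apply] at h'
  rw [mul_comm _ r] at h'
  exact h'.trans (congrArg _ (Finset.sum_congr rfl fun _ _ => mul_comm _ _))

end MatrixProductOperators

/-! ### Polynomials in three variables as lists of monomials -/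

/-- A list of monomials `(c, i, j, k)`, standing for the sum of the `c * x ^ i * y ^ j * t ^ k`. -/
abbrev MonList : Type := List (ℤ × ℕ × ℕ × ℕ)

namespace MonList

/-- The value of a list of monomials. -/
def eval {A : Type*} [CommRing A] (x y t : A) : MonList → A
  | [] => 0
  | (c, i, j, k) :: l => (c : A) * (x ^ i * y ^ j * t ^ k) + eval x y t l

def mulMon (m : ℤ × ℕ × ℕ × ℕ) : MonList → MonList
  | [] => []
  | (c, i, j, k) :: l => (m.1 * c, m.2.1 + i, m.2.2.1 + j, m.2.2.2 + k) :: mulMon m l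

def mul : MonList → MonList → MonList
  | [], _ => []
  | m :: l, r => mulMon m r ++ mul l r

/-- Add a monomial, merging it with the first monomial of the same exponents. -/
def insertMon (m : ℤ × ℕ × ℕ × ℕ) : MonList → MonList
  | [] => [m]
  | (c, i, j, k) :: l =>
    bif Nat.beq m.2.1 i && (Nat.beq m.2.2.1 j && Nat.beq m.2.2.2 k) then (m.1 + c, i, j, k) :: l
    else (c, i, j, k) :: insertMon m l

def collect : MonList → MonList
  | [] => []
  | m :: l => insertMon m (collect l)

def allZero : MonList → Bool
  | [] => true
  | (c, _) :: l => (match c with | Int.ofNat n => Nat.beq n 0 | Int.negSucc _ => false) && allZero l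

/-- A sufficient test for two lists to have the same value. -/
def test (l r : MonList) : Bool := allZero (collect (l ++ mulMon (-1, 0, 0, 0) r))

/-- The concatenation of a family of lists over the elements of `l`. -/
def bind {α : Type*} (l : List α) (f : α → MonList) : MonList :=
  match l with
  | [] => []
  | a :: l => f a ++ bind l f

variable {A : Type*} [CommRing A] (x y t : A)

theorem eval_append (l l' : MonList) : eval x y t (l ++ l') = eval x y t l + eval x y t l' := by
  induction l with
  | nil => simp [eval]
  | cons m l ih => simp [eval, ih, add_assoc]

theorem eval_mulMon (m : ℤ × ℕ × ℕ × ℕ) (l : MonList) :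
    eval x y t (mulMon m l) =
      (m.1 : A) * (x ^ m.2.1 * y ^ m.2.2.1 * t ^ m.2.2.2) * eval x y t l := by
  induction l with
  | nil => simp [eval, mulMon]
  | cons m' l ih => simp only [eval, mulMon, ih, Int.cast_mul, pow_add]; ring

theorem eval_mul (l l' : MonList) : eval x y t (mul l l') = eval x y t l * eval x y t l' := by
  induction l with
  | nil => simp [eval, mul]
  | cons m l ih => rw [mul, eval_append, eval_mulMon, ih, eval, add_mul]

theorem eval_insertMon (m : ℤ × ℕ × ℕ × ℕ) (l : MonList) :
    eval x y t (insertMon m l) =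
      (m.1 : A) * (x ^ m.2.1 * y ^ m.2.2.1 * t ^ m.2.2.2) + eval x y t l := by
  induction l with
  | nil => simp [eval, insertMon]
  | cons m' l ih =>
    rw [insertMon]
    cases h : (Nat.beq m.2.1 m'.2.1 && (Nat.beq m.2.2.1 m'.2.2.1 && Nat.beq m.2.2.2 m'.2.2.2)) with
    | true =>
      simp only [Bool.and_eq_true, Nat.beq_eq] at h
      rw [cond_true, eval, eval, h.1, h.2.1, h.2.2]
      push_cast
      ring
    | false => rw [cond_false, eval, ih, eval]; ring

theorem eval_collect (l : MonList) : eval x y t (collect l) = eval x y t l := by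
  induction l with
  | nil => rfl
  | cons m l ih => rw [collect, eval_insertMon, ih, eval]

theorem eval_allZero {l : MonList} (h : allZero l = true) : eval x y t l = 0 := by
  induction l with
  | nil => rfl
  | cons m l ih =>
    obtain ⟨c, i, j, k⟩ := m
    simp only [allZero, Bool.and_eq_true] at h
    have hc : c = 0 := by
      rcases c with n | n
      · have := Nat.eq_of_beq_eq_true h.1
        simp [this]
      · exact absurd h.1 (by simp)
    rw [eval, ih h.2, hc]
    simp

theorem eval_eq_of_test {l l' : MonList} (h : test l l' = true) :
    eval x y t l = eval x y t l' := by
  have := eval_allZero x y t h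
  rw [eval_collect, eval_append, eval_mulMon] at this
  simp only [Int.cast_neg, Int.cast_one, pow_zero, mul_one, neg_mul, one_mul] at this
  exact add_neg_eq_zero.1 this

theorem eval_bind {α : Type*} (l : List α) (f : α → MonList) :
    eval x y t (bind l f) = (l.map fun a => eval x y t (f a)).sum := by
  induction l with
  | nil => rfl
  | cons a l ih => rw [bind, eval_append, ih, List.map_cons, List.sum_cons]

end MonList

/-! ### The local weights -/

/-- The occupation of a site or of a horizontal edge by particles of the two colours. -/
abbrev Occ : Type := Bool × Bool

namespace Occ

def all : List Occ := [(false, false), (false, true), (true, false), (true, true)]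

theorem sum_all {M : Type*} [AddCommMonoid M] (f : Occ → M) : (all.map f).sum = ∑ a, f a := by
  have : (Finset.univ : Finset Occ) = all.toFinset := by decide
  rw [this, List.sum_toFinset _ (by decide)]

end Occ

/-- A particle of one colour enters a site from the left (`b`) or from below (`s`), but not both,
and leaves it upwards (`s'`) or to the right (`b'`). -/
def conserves (b s s' b' : Bool) : Bool :=
  !(b && s) && (!(s' && b') && (bif b || s then s' || b' else !(s' || b')))

def laxAllowed (b s u r : Occ) : Bool := conserves b.1 s.1 u.1 r.1 && conserves b.2 s.2 u.2 r.2

/-- The number of particles leaving to the right. -/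
def laxXExp (r : Occ) : ℕ := r.1.toNat + r.2.toNat

/-- Whether the first colour leaves to the right in the presence of the second. -/
def laxTExp (b s r : Occ) : ℕ := (r.1 && (b.2 || s.2)).toNat

/-- The local weight of the vertex model. -/
def lax {A : Type*} [CommRing A] (x t : A) (s s' : Occ) : Matrix Occ Occ A := fun b b' =>
  if laxAllowed b s s' b' then x ^ laxXExp b' * t ^ laxTExp b s b' else 0

def laxMonX (b s s' b' : Occ) : MonList :=
  bif laxAllowed b s s' b' then [(1, laxXExp b', 0, laxTExp b s b')] else []

def laxMonY (b s s' b' : Occ) : MonList :=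
  bif laxAllowed b s s' b' then [(1, 0, laxXExp b', laxTExp b s b')] else []

section
variable {A : Type*} [CommRing A] (x y t : A)

theorem eval_laxMonX (b s s' b' : Occ) :
    (laxMonX b s s' b').eval x y t = lax x t s s' b b' := by
  rw [laxMonX, lax]
  cases laxAllowed b s s' b' <;> simp [MonList.eval]

theorem eval_laxMonY (b s s' b' : Occ) :
    (laxMonY b s s' b').eval x y t = lax y t s s' b b' := by
  rw [laxMonY, lax]
  cases laxAllowed b s s' b' <;> simp [MonList.eval]

end

/-- The weights of the crossing of two horizontal lines with parameters `l` and `r`, for one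
colour. -/
def crossOne (l r : MonList) : Bool → Bool → Bool → Bool → MonList
  | false, false, false, false => l
  | true, true, true, true => r
  | false, true, true, false => l
  | true, false, false, true => r
  | true, false, true, false => l ++ MonList.mulMon (-1, 0, 0, 0) r
  | _, _, _, _ => []

/-- The weights of the crossing of two horizontal lines. -/
def crossMon (b c : Occ × Occ) : MonList :=
  match crossOne [(1, 1, 0, 0)] [(1, 0, 1, 0)] b.1.2 b.2.2 c.1.2 c.2.2 with
  | [] => []
  | l => MonList.mul l <| crossOne [(1, 1, 0, 1)]
      [(1, 0, 1, bif b.1.2 && !b.2.2 && c.1.2 && !c.2.2 then 0 else 1)] b.1.1 b.2.1 c.1.1 c.2.1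

/-- Skip the evaluation of the second factor of a product when the first is zero. -/
def lazyMul (l : MonList) (f : Unit → MonList) : MonList :=
  match l with
  | [] => []
  | l => MonList.mul l (f ())

theorem lazyMul_eq (l : MonList) (f : Unit → MonList) : lazyMul l f = MonList.mul l (f ()) := by
  cases l <;> rfl

def crossLeft (s s' b₁ b₂ d₁ d₂ : Occ) : MonList :=
  .bind Occ.all fun c₁ => .bind Occ.all fun c₂ => lazyMul (crossMon (b₁, b₂) (c₁, c₂)) fun _ =>
    .bind Occ.all fun m => lazyMul (laxMonX c₁ s m d₁) fun _ => laxMonY c₂ m s' d₂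

def crossRight (s s' b₁ b₂ d₁ d₂ : Occ) : MonList :=
  .bind Occ.all fun c₁ => .bind Occ.all fun c₂ => lazyMul (crossMon (c₁, c₂) (d₁, d₂)) fun _ =>
    .bind Occ.all fun m => lazyMul (laxMonX b₁ m s' c₁) fun _ => laxMonY b₂ s m c₂

/-- The numbers of particles of the two colours. -/
def Occ.count (a : Occ) : ℕ × ℕ := (a.1.toNat, a.2.toNat)

def crossTest : Bool :=
  Occ.all.all fun s => Occ.all.all fun s' => Occ.all.all fun b₁ => Occ.all.all fun b₂ =>
    Occ.all.all fun d₁ => Occ.all.all fun d₂ =>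
      bif Nat.beq (b₁.1.toNat + b₂.1.toNat + s.1.toNat) (d₁.1.toNat + d₂.1.toNat + s'.1.toNat) &&
        Nat.beq (b₁.2.toNat + b₂.2.toNat + s.2.toNat) (d₁.2.toNat + d₂.2.toNat + s'.2.toNat)
      then MonList.test (crossLeft s s' b₁ b₂ d₁ d₂) (crossRight s s' b₁ b₂ d₁ d₂) else true

theorem crossTest_eq : crossTest = true := by decide +kernel

theorem Occ.mem_all (a : Occ) : a ∈ Occ.all := by revert a; decide

theorem crossMon_eq_nil : ∀ b c : Occ × Occ, crossMon b c ≠ [] →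
    b.1.count + b.2.count = c.1.count + c.2.count := by decide +kernel

theorem count_of_laxAllowed : ∀ b s s' b' : Occ, laxAllowed b s s' b' = true →
    b.count + s.count = s'.count + b'.count := by decide +kernel

section
open Matrix Kronecker
variable {A : Type*} [CommRing A] (x y t : A)

/-- The crossing of two horizontal lines, as a matrix. -/
def crossMat : Matrix (Occ × Occ) (Occ × Occ) A := fun b c => (crossMon b c).eval x y t

theorem crossMat_eq_zero {b c : Occ × Occ}
    (h : b.1.count + b.2.count ≠ c.1.count + c.2.count) : crossMat x y t b c = 0 := by
  have : crossMon b c = [] := by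
    by_contra h'
    exact h (crossMon_eq_nil b c h')
  rw [crossMat, this, MonList.eval]

theorem lax_eq_zero {b s s' b' : Occ} (h : b.count + s.count ≠ s'.count + b'.count) :
    lax x t s s' b b' = 0 := by
  rw [lax, if_neg]
  exact fun h' => h (count_of_laxAllowed _ _ _ _ h')

theorem crossMat_mul_lax (s s' : Occ) :
    crossMat x y t * (∑ m, lax x t s m ⊗ₖ lax y t m s') =
      (∑ m, lax x t m s' ⊗ₖ lax y t s m) * crossMat x y t := by
  ext ⟨b₁, b₂⟩ ⟨d₁, d₂⟩
  simp only [Matrix.mul_apply, Matrix.sum_apply, kroneckerMap_apply,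
    Fintype.sum_prod_type (α₁ := Occ)]
  by_cases hc : b₁.count + b₂.count + s.count = d₁.count + d₂.count + s'.count
  · have h := crossTest_eq
    simp only [crossTest, List.all_eq_true] at h
    have h := h s s.mem_all s' s'.mem_all b₁ b₁.mem_all b₂ b₂.mem_all d₁ d₁.mem_all d₂ d₂.mem_all
    have hc' := Prod.ext_iff.1 hc
    simp only [Occ.count, Prod.fst_add, Prod.snd_add] at hc'
    rw [hc'.1, hc'.2, Nat.beq_refl, Nat.beq_refl, Bool.and_self, cond_true] at h
    have h := MonList.eval_eq_of_test x y t h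
    simp only [crossLeft, crossRight, MonList.eval_bind, lazyMul_eq, MonList.eval_mul,
      eval_laxMonX, eval_laxMonY, Occ.sum_all] at h
    simp only [crossMat]
    rw [h]
    exact Finset.sum_congr rfl fun _ _ => Finset.sum_congr rfl fun _ _ => mul_comm _ _
  · trans 0
    · refine Finset.sum_eq_zero fun c₁ _ => Finset.sum_eq_zero fun c₂ _ => ?_
      by_cases h₁ : b₁.count + b₂.count = c₁.count + c₂.count
      · rw [Finset.sum_eq_zero, mul_zero]
        intro m _
        by_cases h₂ : c₁.count + s.count = m.count + d₁.count
        · by_cases h₃ : c₂.count + m.count = s'.count + d₂.count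
          · refine absurd ?_ hc
            simp only [Prod.ext_iff, Prod.fst_add, Prod.snd_add] at h₁ h₂ h₃ ⊢
            omega
          · rw [lax_eq_zero y t h₃, mul_zero]
        · rw [lax_eq_zero x t h₂, zero_mul]
      · rw [crossMat_eq_zero x y t h₁, zero_mul]
    · refine (Finset.sum_eq_zero fun c₁ _ => Finset.sum_eq_zero fun c₂ _ => ?_).symm
      by_cases h₁ : c₁.count + c₂.count = d₁.count + d₂.count
      · rw [Finset.sum_eq_zero, zero_mul]
        intro m _
        by_cases h₂ : b₁.count + m.count = s'.count + c₁.count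
        · by_cases h₃ : b₂.count + s.count = m.count + c₂.count
          · refine absurd ?_ hc
            simp only [Prod.ext_iff, Prod.fst_add, Prod.snd_add] at h₁ h₂ h₃ ⊢
            omega
          · rw [lax_eq_zero y t h₃, mul_zero]
        · rw [lax_eq_zero x t h₂, zero_mul]
      · rw [crossMat_eq_zero x y t h₁, mul_zero]

end

/-! ### The raising operator -/

/-- The factor that the raising operator picks up at the sites to the left of its action. -/
def cartanMon : Occ → MonList
  | (false, false) => [(1, 0, 0, 0)]
  | (true, false) => [(-1, 0, 0, 1)]
  | (false, true) => [(-1, 0, 0, 0)]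
  | (true, true) => [(1, 0, 0, 1)]

def Occ.beq : Occ → Occ → Bool
  | (false, false), (false, false) => true
  | (true, false), (true, false) => true
  | (false, true), (false, true) => true
  | (true, true), (true, true) => true
  | _, _ => false

theorem Occ.beq_eq : ∀ a b : Occ, a.beq b = decide (a = b) := by decide

/-- Replacing a particle of the second colour by one of the first. -/
def Occ.raises : Occ → Occ → Bool
  | (false, true), (true, false) => true
  | _, _ => false

def raiseMon (s s' : Occ) : Bool → Bool → MonList
  | false, false => bif s.beq s' then cartanMon s else []
  | true, true => bif s.beq s' then [(1, 0, 0, 0)] else []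
  | false, true => bif s.raises s' then [(1, 0, 0, 0)] else []
  | true, false => []

def raiseTest : Bool :=
  Occ.all.all fun s => Occ.all.all fun s' => [false, true].all fun i => Occ.all.all fun b =>
    [false, true].all fun j => Occ.all.all fun d => MonList.test
      (.bind [false, true] fun k => .bind Occ.all fun c => lazyMul (raiseMon b c i k) fun _ =>
        .bind Occ.all fun m => lazyMul (raiseMon s m k j) fun _ => laxMonX c m s' d)
      (.bind [false, true] fun k => .bind Occ.all fun c => lazyMul (raiseMon c d k j) fun _ =>
        .bind Occ.all fun m => lazyMul (raiseMon m s' i k) fun _ => laxMonX b s m c)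

theorem raiseTest_eq : raiseTest = true := by decide +kernel

section
open Matrix Kronecker
variable {A : Type*} [CommRing A] (x t : A)

/-- The local tensor of the raising operator. -/
def raiseTensor (s s' : Occ) : Matrix Bool Bool A := fun i j => (raiseMon s s' i j).eval 0 0 t

/-- The intertwiner has the same entries as the raising operator on the horizontal edge. -/
def raiseCross : Matrix (Bool × Occ) (Bool × Occ) A := fun b c => raiseTensor t b.2 c.2 b.1 c.1

theorem eval_raiseMon (y : A) (s s' : Occ) (i j : Bool) :
    (raiseMon s s' i j).eval x y t = raiseTensor t s s' i j := by
  revert s s' i j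
  simp only [raiseTensor]
  rintro ⟨_ | _, _ | _⟩ ⟨_ | _, _ | _⟩ (_ | _) (_ | _) <;>
    simp [raiseMon, cartanMon, Occ.beq, Occ.raises, MonList.eval]

theorem sum_bool_list {M : Type*} [AddCommMonoid M] (f : Bool → M) :
    ([false, true].map f).sum = ∑ a, f a := by
  simp [add_comm]

theorem raiseCross_mul_lax (s s' : Occ) :
    raiseCross t * (∑ m, raiseTensor t s m ⊗ₖ lax x t m s') =
      (∑ m, raiseTensor t m s' ⊗ₖ lax x t s m) * raiseCross t := by
  ext ⟨i, b⟩ ⟨j, d⟩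
  have h := raiseTest_eq
  simp only [raiseTest, List.all_eq_true] at h
  have hb : ∀ i : Bool, i ∈ [false, true] := by decide
  have h := MonList.eval_eq_of_test x 0 t
    (h s s.mem_all s' s'.mem_all i (hb i) b b.mem_all j (hb j) d d.mem_all)
  simp only [MonList.eval_bind, lazyMul_eq, MonList.eval_mul, eval_raiseMon,
      eval_laxMonX, Occ.sum_all, sum_bool_list] at h
  simp only [Matrix.mul_apply, Matrix.sum_apply, kroneckerMap_apply,
    Fintype.sum_prod_type (α₁ := Bool) (α₂ := Occ), raiseCross]
  rw [h]
  exact Finset.sum_congr rfl fun _ _ => Finset.sum_congr rfl fun _ _ => mul_comm _ _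

end

/-! ### Row transfer operators -/

section
open Matrix
variable {A : Type*} [CommRing A] (x y t : A)

/-- The state without particles. -/
abbrev Occ.empty : Occ := (false, false)

/-- The row transfer operator on `K` sites. -/
def rowOp (K : ℕ) : Matrix (Fin K → Occ) (Fin K → Occ) A :=
  Matrix.of fun S S' => mpo (lax x t) S S' Occ.empty Occ.empty

/-- The raising operator on `K` sites. -/
def raiseOp (K : ℕ) : Matrix (Fin K → Occ) (Fin K → Occ) A :=
  Matrix.of fun S S' => mpo (raiseTensor t) S S' false true

theorem rowOp_comm [IsDomain A] (hx : x ≠ 0) (ht : t ≠ 0) (K : ℕ) :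
    Commute (rowOp x t K) (rowOp y t K) := by
  have hrow : ∀ k, crossMat x y t (Occ.empty, Occ.empty) k =
      if k = (Occ.empty, Occ.empty) then x * (x * t) else 0 := by
    rintro ⟨⟨_ | _, _ | _⟩, _ | _, _ | _⟩ <;>
      simp [crossMat, crossMon, crossOne, MonList.mul, MonList.eval, MonList.mulMon, Occ.empty,
        ← mul_assoc, pow_two]
  have hcol : ∀ k, crossMat x y t k (Occ.empty, Occ.empty) =
      if k = (Occ.empty, Occ.empty) then x * (x * t) else 0 := by
    rintro ⟨⟨_ | _, _ | _⟩, _ | _, _ | _⟩ <;>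
      simp [crossMat, crossMon, crossOne, MonList.mul, MonList.eval, MonList.mulMon, Occ.empty,
        ← mul_assoc, pow_two]
  ext S S'
  exact mul_left_cancel₀ (mul_ne_zero hx (mul_ne_zero hx ht))
    (mpo_commute _ _ _ (crossMat_mul_lax x y t) hrow hcol S S')

theorem raiseOp_comm (K : ℕ) : Commute (raiseOp t K) (rowOp x t K) := by
  have hrow : ∀ k, raiseCross t (false, Occ.empty) k =
      if k = (false, Occ.empty) then (1 : A) else 0 := by
    rintro ⟨_ | _, _ | _, _ | _⟩ <;>
      simp [raiseCross, raiseTensor, raiseMon, cartanMon, Occ.beq, Occ.raises, MonList.eval,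
        Occ.empty]
  have hcol : ∀ k, raiseCross t k (true, Occ.empty) =
      if k = (true, Occ.empty) then (1 : A) else 0 := by
    rintro ⟨_ | _, _ | _, _ | _⟩ <;>
      simp [raiseCross, raiseTensor, raiseMon, Occ.beq, Occ.raises, MonList.eval, Occ.empty]
  ext S S'
  have := mpo_commute _ _ _ (raiseCross_mul_lax x t) hrow hcol S S'
  rwa [one_mul, one_mul] at this

/-- The factor that the raising operator picks up at the sites to the left of its action. -/
def cartan (s : Occ) : A := (cartanMon s).eval 0 0 t

theorem raiseTensor_false_false (s s' : Occ) :
    raiseTensor t s s' false false = if s = s' then cartan t s else 0 := by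
  simp only [raiseTensor, raiseMon, Occ.beq_eq, cartan]
  split_ifs with h <;> simp [h, MonList.eval]

theorem raiseTensor_true_true (s s' : Occ) :
    raiseTensor t s s' true true = if s = s' then (1 : A) else 0 := by
  simp only [raiseTensor, raiseMon, Occ.beq_eq]
  split_ifs with h <;> simp [h, MonList.eval]

theorem raiseTensor_true_false (s s' : Occ) : raiseTensor t s s' true false = (0 : A) := rfl

theorem raiseTensor_false_true (s s' : Occ) :
    raiseTensor t s s' false true =
      if s = (false, true) ∧ s' = (true, false) then (1 : A) else 0 := by
  revert s s'
  rintro ⟨_ | _, _ | _⟩ ⟨_ | _, _ | _⟩ <;>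
    simp [raiseTensor, raiseMon, Occ.raises, MonList.eval]

theorem mpo_raiseTensor_true {K : ℕ} (S S' : Fin K → Occ) :
    mpo (raiseTensor t) S S' true true = if S = S' then (1 : A) else 0 := by
  induction K with
  | zero => simp [mpo, Subsingleton.elim S S']
  | succ K ih =>
    obtain ⟨s, S, rfl⟩ : ∃ s T, S = Fin.cons s T := ⟨_, _, (Fin.cons_self_tail S).symm⟩
    obtain ⟨s', S', rfl⟩ : ∃ s T, S' = Fin.cons s T := ⟨_, _, (Fin.cons_self_tail S').symm⟩
    rw [mpo_cons, Matrix.mul_apply, Fintype.sum_bool, raiseTensor_true_false, zero_mul, add_zero,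
      ih, raiseTensor_true_true]
    simp only [Fin.cons_inj]
    split_ifs <;> simp_all

theorem mul_raiseOp_apply {K : ℕ} (ψ : (Fin K → Occ) → A) (S : Fin K → Occ) :
    ∑ S', ψ S' * raiseOp t K S' S =
      ∑ i, if S i = (true, false) then (∏ p, if p < i then cartan t (S p) else 1) *
        ψ (Function.update S i (false, true)) else 0 := by
  induction K with
  | zero => simp [raiseOp, mpo]
  | succ K ih =>
    obtain ⟨s, S, rfl⟩ : ∃ s T, S = Fin.cons s T := ⟨_, _, (Fin.cons_self_tail S).symm⟩
    have h0 : ∀ s' (S' : Fin K → Occ), raiseOp t (K + 1) (Fin.cons s' S') (Fin.cons s S) =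
        (if s' = s then cartan t s * raiseOp t K S' S else 0) +
        if S' = S then (if s' = (false, true) ∧ s = (true, false) then (1 : A) else 0) else 0 := by
      intro s' S'
      simp only [raiseOp, Matrix.of_apply]
      rw [mpo_cons, Matrix.mul_apply, Fintype.sum_bool, mpo_raiseTensor_true,
        raiseTensor_false_true, raiseTensor_false_false, add_comm]
      congr 1
      · split_ifs with h
        · rw [h]
        · rw [zero_mul]
      · rw [mul_ite, mul_one, mul_zero]
    rw [sum_fin_cons]
    simp only [h0, mul_add, Finset.sum_add_distrib, mul_ite, mul_zero, Finset.sum_ite_eq',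
      Finset.mem_univ, if_true, Fin.sum_univ_succ, Fin.cons_zero, Fin.cons_succ]
    rw [add_comm]
    congr 1
    · by_cases hs : s = (true, false)
      · simp [hs]
      · simp [hs]
    · rw [Finset.sum_comm]
      simp only [Finset.sum_ite_eq', Finset.mem_univ, if_true]
      have := ih (fun S' => cartan t s * ψ (Fin.cons s S')) S
      simp only [mul_left_comm _ (cartan t s), mul_assoc, Fin.prod_univ_succ, Fin.succ_pos, if_true,
        Fin.cons_zero, Fin.cons_succ, Fin.succ_lt_succ_iff, ← Fin.cons_update] at this ⊢
      exact this

/-- The partition function of the vertex model with row parameters `x` and the given boundary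
states. -/
def partitionFun {N : ℕ} (x : Fin N → A) {K : ℕ} : Matrix (Fin K → Occ) (Fin K → Occ) A :=
  (List.ofFn fun i => rowOp (x i) t K).prod

theorem partitionFun_perm [IsDomain A] {N : ℕ} {x : Fin N → A} (hx : ∀ i, x i ≠ 0) (ht : t ≠ 0)
    {K : ℕ} (e : Equiv.Perm (Fin N)) :
    partitionFun t (x ∘ e) = partitionFun t x (K := K) := by
  refine List.Perm.prod_eq' ?_ ?_
  · exact (Equiv.Perm.ofFn_comp_perm e (fun i => rowOp (x i) t K))
  · rw [List.pairwise_ofFn]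
    intro i j _
    exact rowOp_comm _ _ _ (hx _) ht K

theorem raiseOp_comm_partitionFun {N : ℕ} (x : Fin N → A) (K : ℕ) :
    Commute (raiseOp t K) (partitionFun t x) := by
  refine Commute.list_prod_right _ _ fun m hm => ?_
  obtain ⟨i, rfl⟩ := List.mem_ofFn.1 hm
  exact raiseOp_comm _ _ _

/-- A boundary state in which both colours occupy the same sites. -/
def ColorBalanced {K : ℕ} (S : Fin K → Occ) : Prop := ∀ p, (S p).1 = (S p).2

theorem raiseOp_of_balanced {K : ℕ} {S : Fin K → Occ} (hS : ColorBalanced S) (S' : Fin K → Occ) :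
    raiseOp t K S S' = 0 := by
  induction K with
  | zero => simp [raiseOp, mpo]
  | succ K ih =>
    obtain ⟨s, S, rfl⟩ : ∃ s T, S = Fin.cons s T := ⟨_, _, (Fin.cons_self_tail S).symm⟩
    obtain ⟨s', S', rfl⟩ : ∃ s T, S' = Fin.cons s T := ⟨_, _, (Fin.cons_self_tail S').symm⟩
    have h0 : s ≠ (false, true) := by
      intro h
      have := hS 0
      simp [h] at this
    have ih := ih (S := S) (fun p => by simpa using hS p.succ) S'
    simp only [raiseOp, Matrix.of_apply] at ih ⊢
    rw [mpo_cons, Matrix.mul_apply, Fintype.sum_bool, raiseTensor_false_true, ih]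
    simp [h0]

theorem sum_cartan_partitionFun_eq_zero {N : ℕ} (x : Fin N → A) {K : ℕ} {S₀ : Fin K → Occ}
    (hS₀ : ColorBalanced S₀) (S : Fin K → Occ) :
    (∑ i, if S i = (true, false) then (∏ p, if p < i then cartan t (S p) else 1) *
      partitionFun t x S₀ (Function.update S i (false, true)) else 0) = 0 := by
  rw [← mul_raiseOp_apply t (fun S' => partitionFun t x S₀ S')]
  have h := congrFun (congrFun (raiseOp_comm_partitionFun t x K) S₀) S
  rw [Matrix.mul_apply, Matrix.mul_apply] at h
  rw [← h]
  exact Finset.sum_eq_zero fun S' _ => by rw [raiseOp_of_balanced t hS₀, zero_mul]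

end

/-! ### Matrix entries of the row transfer operator -/

theorem laxAllowed_unique : ∀ b s s' b' b'' : Occ, laxAllowed b s s' b' = true →
    laxAllowed b s s' b'' = true → b' = b'' := by decide +kernel

section
open Matrix
variable {A : Type*} [CommRing A] (x t : A)

theorem mpo_lax_apply {K : ℕ} (S S' : Fin K → Occ) (h : ℕ → Occ)
    (hh : ∀ p : Fin K, laxAllowed (h p) (S p) (S' p) (h (p + 1)) = true) :
    mpo (lax x t) S S' (h 0) (h K) =
      ∏ p : Fin K, x ^ laxXExp (h (p + 1)) * t ^ laxTExp (h p) (S p) (h (p + 1)) := by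
  induction K generalizing h with
  | zero => simp [mpo]
  | succ K ih =>
    obtain ⟨s, S, rfl⟩ : ∃ s T, S = Fin.cons s T := ⟨_, _, (Fin.cons_self_tail S).symm⟩
    obtain ⟨s', S', rfl⟩ : ∃ s T, S' = Fin.cons s T := ⟨_, _, (Fin.cons_self_tail S').symm⟩
    have h0 := hh 0
    have ih := ih S S' (fun p => h (p + 1)) fun p => by simpa using hh p.succ
    simp only [Fin.cons_zero, Fin.val_zero, zero_add] at h0 ih
    rw [mpo_cons, Matrix.mul_apply, Finset.sum_eq_single (h 1), ih, lax, if_pos h0,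
      Fin.prod_univ_succ]
    · simp
    · intro b _ hb
      rw [lax, if_neg, zero_mul]
      exact fun hb' => hb (laxAllowed_unique _ _ _ _ _ hb' h0)
    · simp

theorem exists_edges_of_mpo_lax_ne_zero {K : ℕ} {S S' : Fin K → Occ} {b b' : Occ}
    (h : mpo (lax x t) S S' b b' ≠ 0) :
    ∃ e : ℕ → Occ, e 0 = b ∧ e K = b' ∧
      ∀ p : Fin K, laxAllowed (e p) (S p) (S' p) (e (p + 1)) = true := by
  induction K generalizing b with
  | zero =>
    refine ⟨fun _ => b, rfl, ?_, fun p => p.elim0⟩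
    by_contra hb
    exact h (by simp [mpo, hb])
  | succ K ih =>
    obtain ⟨s, S, rfl⟩ : ∃ s T, S = Fin.cons s T := ⟨_, _, (Fin.cons_self_tail S).symm⟩
    obtain ⟨s', S', rfl⟩ : ∃ s T, S' = Fin.cons s T := ⟨_, _, (Fin.cons_self_tail S').symm⟩
    rw [mpo_cons, Matrix.mul_apply] at h
    obtain ⟨c, -, hc⟩ := Finset.exists_ne_zero_of_sum_ne_zero h
    obtain ⟨e, he, he', hall⟩ := ih (right_ne_zero_of_mul hc)
    have h0 : laxAllowed b s s' c = true := by
      by_contra h0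
      exact left_ne_zero_of_mul hc (if_neg h0)
    refine ⟨fun p => Nat.casesOn p b e, rfl, he', Fin.cases ?_ fun p => ?_⟩
    · simpa [he] using h0
    · simpa using hall p

end

/-! ### Positions of the rows of a partition -/

namespace FixedPartition
variable {m : ℕ} {lam lam' : FixedPartition m}

theorem parts_injective : Function.Injective (parts : FixedPartition m → Fin m → ℕ) := by
  rintro ⟨p, _⟩ ⟨q, _⟩ rfl
  rfl

/-- The position of the particle that belongs to a row. -/
def pos (lam : FixedPartition m) (i : Fin m) : ℕ := lam.parts i + (m - 1 - i)

theorem strictAnti_pos (lam : FixedPartition m) : StrictAnti lam.pos := by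
  intro i j h
  have := lam.antitone_parts h.le
  have h' : (i : ℕ) < j := h
  have := j.2
  simp only [pos]
  omega

/-- Whether a site is occupied. -/
def occ (lam : FixedPartition m) (p : ℕ) : Bool := decide (∃ i, lam.pos i = p)

/-- `lam / lam'` is a horizontal strip. -/
def Interlaces (lam' lam : FixedPartition m) : Prop :=
  (∀ i, lam'.parts i ≤ lam.parts i) ∧ ∀ i i', i < i' → lam.parts i' ≤ lam'.parts i

theorem Interlaces.pos_le (h : Interlaces lam' lam) (i : Fin m) : lam'.pos i ≤ lam.pos i := by
  have := h.1 i
  simp only [pos]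
  omega

theorem Interlaces.pos_lt (h : Interlaces lam' lam) {i i' : Fin m} (hi : i < i') :
    lam.pos i' < lam'.pos i := by
  have := h.2 i i' hi
  have h' : (i : ℕ) < i' := hi
  have := i'.2
  simp only [pos]
  omega

theorem interlaces_of_pos (h₁ : ∀ i, lam'.pos i ≤ lam.pos i)
    (h₂ : ∀ i i', i < i' → lam.pos i' < lam'.pos i) : Interlaces lam' lam := by
  have h₁' : ∀ i, lam'.parts i ≤ lam.parts i := fun i => by
    have := h₁ i
    simp only [pos] at this
    omega
  refine ⟨h₁', fun i i' hi => ?_⟩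
  have hlt : (i : ℕ) < i' := hi
  have hi2 := i'.2
  have := h₂ i ⟨i + 1, by omega⟩ (by simp [Fin.lt_def])
  have hanti : lam.parts i' ≤ lam.parts ⟨i + 1, by omega⟩ := by
    apply lam.antitone_parts
    simp only [Fin.le_def]
    omega
  simp only [pos] at this
  omega

/-- Whether a particle moves from site `p - 1` to site `p`. -/
def edge (lam' lam : FixedPartition m) (p : ℕ) : Bool :=
  decide (∃ i, lam'.pos i < p ∧ p ≤ lam.pos i)

theorem Interlaces.conserves (h : Interlaces lam' lam) (p : ℕ) :
    conserves (edge lam' lam p) (lam'.occ p) (lam.occ p) (edge lam' lam (p + 1)) = true := by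
  have key : ∀ b s s' b' : Bool, ¬ (b = true ∧ s = true) → ¬ (s' = true ∧ b' = true) →
      (b = true ∨ s = true ↔ s' = true ∨ b' = true) → _root_.conserves b s s' b' = true := by
    decide
  apply key <;> simp only [edge, occ, decide_eq_true_eq]
  · rintro ⟨⟨i, hi, hi'⟩, j, rfl⟩
    exact absurd (h.pos_lt ((strictAnti_pos lam').lt_iff_gt.1 hi)) (by omega)
  · rintro ⟨⟨j, rfl⟩, i, hi, hi'⟩
    exact absurd (h.pos_lt ((strictAnti_pos lam).lt_iff_gt.1 (Nat.lt_of_succ_le hi'))) (by omega)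
  · constructor
    · rintro (⟨i, hi, hi'⟩ | ⟨i, hi⟩)
      · rcases hi'.eq_or_lt with h' | h'
        · exact Or.inl ⟨i, h'.symm⟩
        · exact Or.inr ⟨i, by omega, by omega⟩
      · have := h.pos_le i
        rcases this.eq_or_lt with h' | h'
        · exact Or.inl ⟨i, by omega⟩
        · exact Or.inr ⟨i, by omega, by omega⟩
    · rintro (⟨i, hi⟩ | ⟨i, hi, hi'⟩)
      · have := h.pos_le i
        rcases this.eq_or_lt with h' | h'
        · exact Or.inr ⟨i, by omega⟩
        · exact Or.inl ⟨i, by omega, by omega⟩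
      · rcases (Nat.le_of_lt_succ hi).eq_or_lt with h' | h'
        · exact Or.inr ⟨i, h'⟩
        · exact Or.inl ⟨i, by omega, by omega⟩

theorem card_pos_lt_succ (lam : FixedPartition m) (p : ℕ) :
    (Finset.univ.filter fun i => lam.pos i < p + 1).card =
      (Finset.univ.filter fun i => lam.pos i < p).card + (lam.occ p).toNat := by
  have h1 : (Finset.univ.filter fun i => lam.pos i < p + 1) =
      (Finset.univ.filter fun i => lam.pos i < p) ∪
        (Finset.univ.filter fun i => lam.pos i = p) := by
    ext i
    simp
    omega
  rw [h1, Finset.card_union_of_disjoint]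
  · congr 1
    by_cases h : ∃ i, lam.pos i = p
    · obtain ⟨i, hi⟩ := h
      have : (Finset.univ.filter fun j => lam.pos j = p) = {i} := by
        ext j
        simp [← hi, (strictAnti_pos lam).injective.eq_iff]
      rw [this, occ, decide_eq_true ⟨i, hi⟩]
      rfl
    · rw [occ, decide_eq_false h, Finset.filter_false_of_mem]
      · rfl
      · exact fun i _ hi => h ⟨i, hi⟩
  · rw [Finset.disjoint_filter]
    intro i _ h
    omega

theorem toNat_of_conserves : ∀ b s s' b' : Bool, conserves b s s' b' = true →
    b.toNat + s.toNat = s'.toNat + b'.toNat ∧ (s = true → b = false) := by decide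

theorem interlaces_of_conserves {K : ℕ} (hK : ∀ i, lam'.pos i < K) {e : ℕ → Bool}
    (h0 : e 0 = false)
    (he : ∀ p < K, _root_.conserves (e p) (lam'.occ p) (lam.occ p) (e (p + 1)) = true) :
    Interlaces lam' lam := by
  have hcount : ∀ p ≤ K, (Finset.univ.filter fun i => lam'.pos i < p).card =
      (Finset.univ.filter fun i => lam.pos i < p).card + (e p).toNat := by
    intro p hp
    induction p with
    | zero => simp [h0]
    | succ p ih =>
      have := toNat_of_conserves _ _ _ _ (he p hp)
      have := ih (by omega)
      rw [card_pos_lt_succ, card_pos_lt_succ]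
      omega
  have key : ∀ i, (Finset.univ.filter fun j => lam.pos j < lam'.pos i) = Finset.Ioi i := by
    intro i
    have h1 : (Finset.univ.filter fun j => lam'.pos j < lam'.pos i) = Finset.Ioi i := by
      ext j
      simp [(strictAnti_pos lam').lt_iff_gt]
    have h2 := hcount _ (hK i).le
    have h3 := (toNat_of_conserves _ _ _ _ (he _ (hK i))).2 (decide_eq_true ⟨i, rfl⟩)
    rw [h1, h3] at h2
    have h4 : i ∉ Finset.univ.filter fun j => lam.pos j < lam'.pos i := by
      intro hi
      have : Finset.Ici i ⊆ Finset.univ.filter fun j => lam.pos j < lam'.pos i := by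
        intro j hj
        simp only [Finset.mem_filter, Finset.mem_univ, true_and] at hi ⊢
        exact ((strictAnti_pos lam).antitone (Finset.mem_Ici.1 hj)).trans_lt hi
      have := Finset.card_le_card this
      rw [← Finset.Ioi_insert, Finset.card_insert_of_notMem (by simp)] at this
      simp only [Bool.toNat_false, add_zero] at h2
      omega
    refine Finset.eq_of_subset_of_card_le (fun j hj => ?_) (by rw [h2]; simp)
    simp only [Finset.mem_filter, Finset.mem_univ, true_and, not_lt] at hj h4
    rw [Finset.mem_Ioi]
    by_contra hij
    have := (strictAnti_pos lam).antitone (not_lt.1 hij)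
    omega
  refine interlaces_of_pos (fun i => ?_) fun i i' hi => ?_
  · by_contra h
    have : i ∈ Finset.univ.filter fun j => lam.pos j < lam'.pos i := by
      simpa using h
    simp [key] at this
  · have : i' ∈ Finset.univ.filter fun j => lam.pos j < lam'.pos i := by
      rw [key]
      simpa using hi
    simpa using this

/-- Every set of `m` sites comes from a partition with `m` parts. -/
theorem exists_occ_eq (a : ℕ → Bool) {K : ℕ} (ha : ∀ p, a p = true → p < K)
    (hm : ((Finset.range K).filter fun p => a p = true).card = m) :
    ∃ lam : FixedPartition m, (∀ p, lam.occ p = a p) := by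
  set s := (Finset.range K).filter fun p => a p = true with hs
  set f := s.orderEmbOfFin hm
  have hle : ∀ k : Fin m, (k : ℕ) ≤ f k := by
    rintro ⟨k, hk⟩
    induction k with
    | zero => simp
    | succ k ih =>
      have h1 := ih (by omega)
      have h2 : f ⟨k, by omega⟩ < f ⟨k + 1, hk⟩ := f.strictMono (by simp [Fin.lt_def])
      simp only at h1 ⊢
      omega
  have hpos : ∀ i : Fin m, f i.rev - (m - 1 - i) + (m - 1 - i) = f i.rev := fun i => by
    have := hle i.rev
    rw [Fin.val_rev] at this
    omega
  have hstep : ∀ (k : ℕ) (i j : Fin m), (j : ℕ) = i + k → f i + k ≤ f j := by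
    intro k
    induction k with
    | zero => intro i j h; rw [Fin.ext (by simpa using h.symm) (a := i) (b := j)]; simp
    | succ k ih =>
      intro i j h
      have hj := j.2
      have h1 := ih i ⟨i + k, by omega⟩ rfl
      have h2 : f ⟨i + k, by omega⟩ < f j := f.strictMono (by simp only [Fin.lt_def]; omega)
      omega
  refine ⟨⟨fun i => f i.rev - (m - 1 - i), fun i j hij => ?_⟩, fun p => ?_⟩
  · have hij' : (i : ℕ) ≤ j := hij
    have := i.2
    have := j.2
    have h1 := hstep (j - i) j.rev i.rev (by rw [Fin.val_rev, Fin.val_rev]; omega)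
    have h2 := hle j.rev
    rw [Fin.val_rev] at h2
    simp only
    omega
  · rw [occ, Bool.eq_iff_iff, decide_eq_true_eq]
    have : a p = true ↔ p ∈ s := by
      rw [hs, Finset.mem_filter, Finset.mem_range]
      exact ⟨fun h => ⟨ha p h, h⟩, fun h => h.2⟩
    rw [this, ← Finset.mem_coe, ← Finset.range_orderEmbOfFin s hm, Set.mem_range]
    constructor
    · rintro ⟨i, hi⟩
      exact ⟨i.rev, (hpos i).symm.trans hi⟩
    · rintro ⟨i, hi⟩
      refine ⟨i.rev, (hpos _).trans ?_⟩
      rw [Fin.rev_rev, ← hi]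

theorem occ_injective {lam lam' : FixedPartition m} (h : ∀ p, lam.occ p = lam'.occ p) :
    lam = lam' := by
  have h1 : Set.range (lam.pos ∘ Fin.rev) = Set.range (lam'.pos ∘ Fin.rev) := by
    rw [Fin.rev_surjective.range_comp, Fin.rev_surjective.range_comp]
    ext p
    simpa [occ] using h p
  have mono : ∀ l : FixedPartition m, StrictMono (l.pos ∘ Fin.rev) :=
    fun l => (strictAnti_pos l).comp fun _ _ hij => Fin.rev_lt_rev.2 hij
  have h2 := (StrictMono.range_inj (mono lam) (mono lam')).1 h1
  apply parts_injective
  funext i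
  have := congrFun h2 i.rev
  simp only [Function.comp_apply, Fin.rev_rev, pos] at this
  omega

end FixedPartition

namespace FixedPartition
variable {m m' : ℕ}

theorem occ_eq_false_of_le {lam : FixedPartition m} {K : ℕ} (hK : ∀ i, lam.pos i < K) {p : ℕ}
    (hp : K ≤ p) : lam.occ p = false := by
  rw [occ, decide_eq_false_iff_not]
  rintro ⟨i, rfl⟩
  exact absurd (hK i) (not_lt.2 hp)

theorem Interlaces.pos_lt_of_pos_lt {lam lam' : FixedPartition m} (h : Interlaces lam' lam) {K : ℕ}
    (hK : ∀ i, lam.pos i < K) (i : Fin m) : lam'.pos i < K :=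
  (h.pos_le i).trans_lt (hK i)

theorem edge_zero (lam' lam : FixedPartition m) : edge lam' lam 0 = false := by
  simp [edge]

theorem edge_eq_false {lam' lam : FixedPartition m} {K : ℕ} (hK : ∀ i, lam.pos i < K) :
    edge lam' lam K = false := by
  rw [edge, decide_eq_false_iff_not]
  rintro ⟨i, -, h⟩
  exact absurd (hK i) (not_lt.2 h)

theorem exists_interlaces_of_conserves {lam : FixedPartition m} {K : ℕ} (hK : ∀ i, lam.pos i < K)
    {a e : ℕ → Bool} (ha : ∀ p, a p = true → p < K) (h0 : e 0 = false) (h1 : e K = false)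
    (he : ∀ p < K, conserves (e p) (a p) (lam.occ p) (e (p + 1)) = true) :
    ∃ lam' : FixedPartition m, Interlaces lam' lam ∧ ∀ p, lam'.occ p = a p := by
  have hcount : ∀ p ≤ K, ((Finset.range p).filter fun q => a q = true).card =
      (Finset.univ.filter fun i => lam.pos i < p).card + (e p).toNat := by
    intro p hp
    induction p with
    | zero => simp [h0]
    | succ p ih =>
      have h2 := toNat_of_conserves _ _ _ _ (he p hp)
      have h3 := ih (by omega)
      rw [card_pos_lt_succ, Finset.range_add_one, Finset.filter_insert]
      cases hap : a p with
      | true =>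
        rw [if_pos rfl, Finset.card_insert_of_notMem (by simp)]
        rw [hap] at h2
        simp only [Bool.toNat_true] at h2
        omega
      | false =>
        rw [hap] at h2
        simp only [Bool.toNat_false] at h2
        simp only [Bool.false_eq_true, if_false]
        omega
  have hm := hcount K le_rfl
  rw [h1, Finset.filter_true_of_mem fun i _ => hK i, Finset.card_univ, Fintype.card_fin] at hm
  obtain ⟨lam', hl⟩ := exists_occ_eq a ha hm
  refine ⟨lam', interlaces_of_conserves (K := K) (fun i => ?_) h0 fun p hp => ?_, hl⟩
  · apply ha
    rw [← hl, occ, decide_eq_true_eq]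
    exact ⟨i, rfl⟩
  · rw [hl]
    exact he p hp

theorem finite_interlaces (lam : FixedPartition m) : {lam' | Interlaces lam' lam}.Finite :=
  Set.Finite.of_finite_image
    ((Set.finite_Iic lam.parts).subset (by rintro _ ⟨l, hl, rfl⟩; exact hl.1))
    parts_injective.injOn

/-- The finite set of partitions obtained by removing a horizontal strip. -/
noncomputable def stripped (lam : FixedPartition m) : Finset (FixedPartition m) :=
  lam.finite_interlaces.toFinset

theorem mem_stripped {lam lam' : FixedPartition m} : lam' ∈ lam.stripped ↔ Interlaces lam' lam := by
  simp [stripped]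

end FixedPartition

open FixedPartition

section
variable {m m' K : ℕ} {A : Type*} [CommRing A] (x t : A)

/-- The state given by a pair of partitions. -/
def pairState (K : ℕ) (lam : FixedPartition m) (mu : FixedPartition m') : Fin K → Occ :=
  fun p => (lam.occ p, mu.occ p)

/-- The weight of adding the horizontal strips `lam / lam'` and `mu / mu'`. -/
def stripWeight (K : ℕ) (lam' lam : FixedPartition m) (mu' mu : FixedPartition m') : A :=
  ∏ p : Fin K, x ^ ((edge lam' lam (p + 1)).toNat + (edge mu' mu (p + 1)).toNat) *
    t ^ (edge lam' lam (p + 1) && (edge mu' mu p || mu'.occ p)).toNat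

theorem rowOp_pairState {lam' lam : FixedPartition m} {mu' mu : FixedPartition m'}
    (hlam : ∀ i, lam.pos i < K) (hmu : ∀ i, mu.pos i < K)
    (hl : Interlaces lam' lam) (hm : Interlaces mu' mu) :
    rowOp x t K (pairState K lam' mu') (pairState K lam mu) =
      stripWeight x t K lam' lam mu' mu := by
  have := mpo_lax_apply x t (pairState K lam' mu') (pairState K lam mu)
    (fun p => (edge lam' lam p, edge mu' mu p)) fun p => by
      rw [laxAllowed, Bool.and_eq_true]
      exact ⟨hl.conserves p, hm.conserves p⟩
  simp only [edge_zero, edge_eq_false hlam, edge_eq_false hmu] at this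
  exact this

theorem exists_of_rowOp_ne_zero {lam : FixedPartition m} {mu : FixedPartition m'}
    (hlam : ∀ i, lam.pos i < K) (hmu : ∀ i, mu.pos i < K) {S : Fin K → Occ}
    (h : rowOp x t K S (pairState K lam mu) ≠ 0) :
    ∃ lam' ∈ lam.stripped, ∃ mu' ∈ mu.stripped, pairState K lam' mu' = S := by
  obtain ⟨e, h0, h1, he⟩ := exists_edges_of_mpo_lax_ne_zero x t h
  simp only [laxAllowed, Bool.and_eq_true] at he
  obtain ⟨lam', hl, hl'⟩ := exists_interlaces_of_conserves hlam
    (a := fun p => if h : p < K then (S ⟨p, h⟩).1 else false) (e := fun p => (e p).1)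
    (fun p hp => by by_contra hK; simp [hK] at hp) (by rw [h0]) (by rw [h1])
    (fun p hp => by simpa [hp, pairState] using (he ⟨p, hp⟩).1)
  obtain ⟨mu', hm, hm'⟩ := exists_interlaces_of_conserves hmu
    (a := fun p => if h : p < K then (S ⟨p, h⟩).2 else false) (e := fun p => (e p).2)
    (fun p hp => by by_contra hK; simp [hK] at hp) (by rw [h0]) (by rw [h1])
    (fun p hp => by simpa [hp, pairState] using (he ⟨p, hp⟩).2)
  refine ⟨lam', mem_stripped.2 hl, mu', mem_stripped.2 hm, funext fun p => ?_⟩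
  simp [pairState, hl', hm']

theorem pairState_injective {lam lam' : FixedPartition m} {mu mu' : FixedPartition m'}
    (hlam : ∀ i, lam.pos i < K) (hmu : ∀ i, mu.pos i < K)
    (hlam' : ∀ i, lam'.pos i < K) (hmu' : ∀ i, mu'.pos i < K)
    (h : pairState K lam mu = pairState K lam' mu') : lam = lam' ∧ mu = mu' := by
  constructor <;> refine occ_injective fun p => ?_ <;> by_cases hp : p < K
  · exact congrArg Prod.fst (congrFun h ⟨p, hp⟩)
  · rw [occ_eq_false_of_le hlam (not_lt.1 hp), occ_eq_false_of_le hlam' (not_lt.1 hp)]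
  · exact congrArg Prod.snd (congrFun h ⟨p, hp⟩)
  · rw [occ_eq_false_of_le hmu (not_lt.1 hp), occ_eq_false_of_le hmu' (not_lt.1 hp)]

theorem sum_mul_rowOp {lam : FixedPartition m} {mu : FixedPartition m'}
    (hlam : ∀ i, lam.pos i < K) (hmu : ∀ i, mu.pos i < K) (ψ : (Fin K → Occ) → A) :
    ∑ S, ψ S * rowOp x t K S (pairState K lam mu) =
      ∑ lam' ∈ lam.stripped, ∑ mu' ∈ mu.stripped,
        ψ (pairState K lam' mu') * stripWeight x t K lam' lam mu' mu := by
  classical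
  rw [← Finset.sum_product']
  have hinj : Set.InjOn (fun q : FixedPartition m × FixedPartition m' => pairState K q.1 q.2)
      (lam.stripped ×ˢ mu.stripped : Finset _) := by
    rintro ⟨l, u⟩ h ⟨l', u'⟩ h' heq
    simp only [Finset.coe_product, Set.mem_prod, Finset.mem_coe, mem_stripped] at h h'
    have := pairState_injective (h.1.pos_lt_of_pos_lt hlam) (h.2.pos_lt_of_pos_lt hmu)
      (h'.1.pos_lt_of_pos_lt hlam) (h'.2.pos_lt_of_pos_lt hmu) heq
    exact Prod.ext this.1 this.2
  trans ∑ S ∈ (lam.stripped ×ˢ mu.stripped).image (fun q => pairState K q.1 q.2),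
    ψ S * rowOp x t K S (pairState K lam mu)
  · refine (Finset.sum_subset (Finset.subset_univ _) fun S _ hS => ?_).symm
    by_contra hne
    obtain ⟨l, hl, u, hu, rfl⟩ := exists_of_rowOp_ne_zero x t hlam hmu (right_ne_zero_of_mul hne)
    exact hS (Finset.mem_image.2 ⟨(l, u), Finset.mem_product.2 ⟨hl, hu⟩, rfl⟩)
  · rw [Finset.sum_image hinj]
    refine Finset.sum_congr rfl fun q hq => ?_
    rw [Finset.mem_product, mem_stripped, mem_stripped] at hq
    rw [rowOp_pairState x t hlam hmu hq.1 hq.2]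

theorem partitionFun_succ {N : ℕ} (x : Fin (N + 1) → A) (S S' : Fin K → Occ) :
    partitionFun t x S S' = ∑ S'', partitionFun t (x ∘ Fin.castSucc) S S'' *
      rowOp (x (Fin.last N)) t K S'' S' := by
  rw [partitionFun, List.ofFn_succ', List.concat_eq_append, List.prod_append,
    List.prod_singleton, Matrix.mul_apply]
  rfl

end

theorem exists_threshold {k : ℕ} (p : Fin k → Prop) (hp : ∀ i j, i ≤ j → p j → p i) :
    ∃ c ≤ k, ∀ j : Fin k, p j ↔ (j : ℕ) < c := by
  classical
  by_cases h : ∃ j : ℕ, ∃ hj : j < k, ¬ p ⟨j, hj⟩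
  · obtain ⟨hk, hn⟩ := Nat.find_spec h
    refine ⟨Nat.find h, hk.le, fun j => ⟨fun hj => ?_, fun hj => ?_⟩⟩
    · by_contra hlt
      exact hn (hp _ j (not_lt.1 hlt) hj)
    · by_contra hpj
      exact Nat.find_min h hj ⟨j.2, hpj⟩
  · push Not at h
    exact ⟨k, le_rfl, fun j => ⟨fun _ => j.2, fun _ => h j j.2⟩⟩

namespace FixedPartition
variable {m m' : ℕ}

variable {N : ℕ}

/-- Extend a filling of `lam'` to `lam` by the largest letter. -/
def extend (lam' lam : FixedPartition m) (T : lam'.Cell → Fin N) : lam.Cell → Fin (N + 1) :=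
  fun c => if h : (c.2 : ℕ) < lam'.parts c.1 then (T ⟨c.1, ⟨c.2, h⟩⟩).castSucc else Fin.last N

theorem extend_eq_last_iff {lam' lam : FixedPartition m} {T : lam'.Cell → Fin N} {c : lam.Cell} :
    extend lam' lam T c = Fin.last N ↔ lam'.parts c.1 ≤ c.2 := by
  rw [extend]
  split_ifs with h
  · simp [Fin.castSucc_ne_last, h]
  · simpa using h

theorem mem_ssyt {lam : FixedPartition m} {T : lam.Cell → Fin N} :
    T ∈ lam.ssyt N ↔ lam.IsSemistandard T := by
  simp [ssyt]

theorem Interlaces.isSemistandard_extend {lam' lam : FixedPartition m} (h : Interlaces lam' lam)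
    {T : lam'.Cell → Fin N} (hT : lam'.IsSemistandard T) :
    lam.IsSemistandard (extend lam' lam T) := by
  constructor
  · intro i j j' hj
    by_cases h' : (j' : ℕ) < lam'.parts i
    · have hj0 : (j : ℕ) < lam'.parts i := lt_of_le_of_lt hj h'
      simp only [extend, h', hj0, dif_pos]
      exact Fin.castSucc_le_castSucc_iff.2 (hT.1 i ⟨j, hj0⟩ ⟨j', h'⟩ hj)
    · rw [(extend_eq_last_iff (c := ⟨i, j'⟩)).2 (not_lt.1 h')]
      exact Fin.le_last _
  · intro i i' j hj hj' hi
    have h1 : j < lam'.parts i := hj'.trans_le (h.2 i i' hi)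
    by_cases h2 : j < lam'.parts i'
    · simp only [extend, h1, h2, dif_pos]
      exact Fin.castSucc_lt_castSucc_iff.2 (hT.2 i i' j h1 h2 hi)
    · simp only [extend, h1, h2, dif_pos, dif_neg, not_false_eq_true]
      exact Fin.castSucc_lt_last _

theorem extend_injective {lam₁ lam₂ lam : FixedPartition m} (h₁ : Interlaces lam₁ lam)
    (h₂ : Interlaces lam₂ lam) {T₁ : lam₁.Cell → Fin N} {T₂ : lam₂.Cell → Fin N}
    (h : extend lam₁ lam T₁ = extend lam₂ lam T₂) :
    (⟨lam₁, T₁⟩ : Σ l : FixedPartition m, l.Cell → Fin N) = ⟨lam₂, T₂⟩ := by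
  have key : ∀ {l₁ l₂ : FixedPartition m} {T₁ : l₁.Cell → Fin N} {T₂ : l₂.Cell → Fin N},
      Interlaces l₂ lam → extend l₁ lam T₁ = extend l₂ lam T₂ →
      ∀ i, l₂.parts i ≤ l₁.parts i := by
    intro l₁ l₂ T₁ T₂ h2 h i
    by_contra! hlt
    have := congrFun h ⟨i, ⟨l₁.parts i, hlt.trans_le (h2.1 i)⟩⟩
    rw [extend_eq_last_iff.2 (le_refl _), eq_comm, extend_eq_last_iff] at this
    exact absurd hlt (not_lt.2 this)
  obtain rfl : lam₁ = lam₂ :=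
    parts_injective (funext fun i => le_antisymm (key h₁ h.symm i) (key h₂ h i))
  obtain rfl : T₁ = T₂ := by
    funext ⟨i, j⟩
    have := congrFun h ⟨i, ⟨j, j.2.trans_le (h₁.1 i)⟩⟩
    simpa [extend] using this
  rfl

theorem exists_extend_eq {lam : FixedPartition m} {T : lam.Cell → Fin (N + 1)}
    (hT : lam.IsSemistandard T) :
    ∃ lam', Interlaces lam' lam ∧ ∃ T' : lam'.Cell → Fin N, lam'.IsSemistandard T' ∧
      extend lam' lam T' = T := by
  choose c hc hc' using fun i => exists_threshold (fun j => T ⟨i, j⟩ ≠ Fin.last N)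
    fun j j' hj h => ((hT.1 i j j' hj).trans_lt (lt_of_le_of_ne (Fin.le_last _) h)).ne
  have hcol : ∀ i i', i < i' → lam.parts i' ≤ c i := by
    intro i i' hi
    by_contra! hlt
    have h1 : c i < lam.parts i := hlt.trans_le (lam.antitone_parts hi.le)
    have := (hc' i ⟨c i, h1⟩).1
      ((hT.2 i i' (c i) h1 hlt hi).trans_le (Fin.le_last _)).ne
    exact lt_irrefl _ this
  let lam' : FixedPartition m := ⟨c, fun i i' hi => by
    rcases hi.eq_or_lt with rfl | hi
    · exact le_rfl
    · exact (hc i').trans (hcol i i' hi)⟩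
  have hint : Interlaces lam' lam := ⟨hc, hcol⟩
  have hne : ∀ v : lam'.Cell, T ⟨v.1, ⟨v.2, v.2.2.trans_le (hc v.1)⟩⟩ ≠ Fin.last N :=
    fun v => (hc' v.1 ⟨v.2, v.2.2.trans_le (hc v.1)⟩).2 v.2.2
  refine ⟨lam', hint, fun v => (T ⟨v.1, ⟨v.2, v.2.2.trans_le (hc v.1)⟩⟩).castPred (hne v),
    ⟨fun i j j' hj => ?_, fun i i' j hj hj' hi => ?_⟩, funext fun v => ?_⟩
  · exact Fin.castPred_le_castPred_iff.2 (hT.1 i _ _ hj)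
  · exact Fin.castPred_lt_castPred_iff.2 (hT.2 i i' j _ _ hi)
  · by_cases hv : (v.2 : ℕ) < lam'.parts v.1
    · simp [extend, hv]
    · rw [extend_eq_last_iff.2 (not_lt.1 hv)]
      by_contra hne
      exact hv ((hc' v.1 v.2).1 (Ne.symm hne))

theorem sum_ssyt_succ {M : Type*} [AddCommMonoid M] (lam : FixedPartition m)
    (F : (lam.Cell → Fin (N + 1)) → M) :
    ∑ T ∈ lam.ssyt (N + 1), F T =
      ∑ lam' ∈ lam.stripped, ∑ T ∈ lam'.ssyt N, F (extend lam' lam T) := by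
  rw [Finset.sum_sigma']
  symm
  refine Finset.sum_bij (fun q _ => extend q.1 lam q.2) ?_ ?_ ?_ fun _ _ => rfl
  · rintro ⟨l, T⟩ hq
    rw [Finset.mem_sigma, mem_stripped, mem_ssyt] at hq
    exact mem_ssyt.2 (hq.1.isSemistandard_extend hq.2)
  · rintro ⟨l, T⟩ hq ⟨l', T'⟩ hq' h
    rw [Finset.mem_sigma, mem_stripped] at hq hq'
    exact extend_injective hq.1 hq'.1 h
  · intro T hT
    obtain ⟨l, hl, T', hss, rfl⟩ := exists_extend_eq (mem_ssyt.1 hT)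
    exact ⟨⟨l, T'⟩, Finset.mem_sigma.2 ⟨mem_stripped.2 hl, mem_ssyt.2 hss⟩, rfl⟩

/-- The inclusion of diagrams. -/
def Interlaces.cellEmb {lam' lam : FixedPartition m} (h : Interlaces lam' lam) :
    lam'.Cell ↪ lam.Cell where
  toFun v := ⟨v.1, ⟨v.2, v.2.2.trans_le (h.1 v.1)⟩⟩
  inj' := by
    rintro ⟨i, j⟩ ⟨i', j'⟩ hv
    obtain ⟨rfl, h2⟩ := Sigma.mk.inj_iff.1 hv
    have := congrArg Fin.val (eq_of_heq h2)
    exact Sigma.ext rfl (heq_of_eq (Fin.ext this))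

theorem Interlaces.extend_cellEmb {lam' lam : FixedPartition m} (h : Interlaces lam' lam)
    (T : lam'.Cell → Fin N) (v : lam'.Cell) :
    extend lam' lam T (h.cellEmb v) = (T v).castSucc :=
  dif_pos v.2.2

/-- A product over the cells of a diagram splits off the cells of a horizontal strip. -/
theorem Interlaces.prod_cell {M : Type*} [CommMonoid M] {lam' lam : FixedPartition m}
    (h : Interlaces lam' lam) (f : lam.Cell → M) :
    ∏ v, f v = (∏ v, f (h.cellEmb v)) * ∏ v with lam'.parts v.1 ≤ v.2, f v := by
  rw [← Finset.prod_filter_mul_prod_filter_not Finset.univ fun v : lam.Cell =>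
    (v.2 : ℕ) < lam'.parts v.1]
  simp only [not_lt]
  congr 1
  rw [← Finset.prod_map Finset.univ h.cellEmb]
  refine Finset.prod_congr ?_ fun _ _ => rfl
  ext v
  simp only [Finset.mem_filter, Finset.mem_univ, true_and, Finset.mem_map]
  constructor
  · intro hv
    exact ⟨⟨v.1, ⟨v.2, hv⟩⟩, rfl⟩
  · rintro ⟨w, rfl⟩
    exact w.2.2

/-- The cells of a horizontal strip correspond to the moves of the particles. -/
theorem Interlaces.sum_edge {lam' lam : FixedPartition m} (h : Interlaces lam' lam) {K : ℕ}
    (hK : ∀ i, lam.pos i < K) (G : ℕ → ℕ) :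
    ∑ p : Fin K, (if edge lam' lam (p + 1) = true then G p else 0) =
      ∑ v : lam.Cell with lam'.parts v.1 ≤ v.2, G (v.2 + (m - 1 - v.1)) := by
  rw [← Finset.sum_filter]
  symm
  have hlt : ∀ v : lam.Cell, (v.2 : ℕ) + (m - 1 - v.1) < lam.pos v.1 := fun v => by
    have := v.2.2
    simp only [pos]
    omega
  refine Finset.sum_bij (fun v _ => ⟨v.2 + (m - 1 - v.1), (hlt v).trans (hK v.1)⟩) ?_ ?_ ?_
    fun _ _ => rfl
  · intro v hv
    simp only [Finset.mem_filter, Finset.mem_univ, true_and, edge, decide_eq_true_eq] at hv ⊢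
    exact ⟨v.1, by simp only [pos]; omega, hlt v⟩
  · intro v hv w hw hvw
    simp only [Finset.mem_filter, Finset.mem_univ, true_and, Fin.mk.injEq] at hv hw hvw
    have key : ∀ {v w : lam.Cell}, lam'.parts v.1 ≤ v.2 →
        (v.2 : ℕ) + (m - 1 - v.1) = w.2 + (m - 1 - w.1) → ¬ v.1 < w.1 := by
      intro v w hv hvw hlt'
      have h1 := h.pos_lt hlt'
      have h2 := hlt w
      simp only [pos] at h1 h2
      omega
    have h1 : v.1 = w.1 := le_antisymm (not_lt.1 (key hw hvw.symm)) (not_lt.1 (key hv hvw))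
    obtain ⟨i, j⟩ := v
    obtain ⟨i', j'⟩ := w
    obtain rfl : i = i' := h1
    have : j = j' := Fin.ext (by simpa using hvw)
    rw [this]
  · intro p hp
    simp only [Finset.mem_filter, Finset.mem_univ, true_and, edge, decide_eq_true_eq] at hp
    obtain ⟨i, h1, h2⟩ := hp
    simp only [pos] at h1 h2
    refine ⟨⟨i, ⟨p - (m - 1 - i), by omega⟩⟩, ?_, ?_⟩
    · simp only [Finset.mem_filter, Finset.mem_univ, true_and]
      omega
    · ext
      simp only
      omega

end FixedPartition

section
variable {m m' : ℕ}

variable {N : ℕ}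

/-- The entries of the position `c` of row `r` and of its left neighbour enclose `b`. -/
def Encloses {mu : FixedPartition m'} (U : mu.Cell → Fin N) (r : Fin m') (c : ℕ) (b : Fin N) :
    Prop :=
  c ≤ mu.parts r ∧ (∀ (c' : ℕ) (hc : c' < mu.parts r), c = c' + 1 → U ⟨r, ⟨c', hc⟩⟩ ≤ b) ∧
    ∀ hc : c < mu.parts r, b ≤ U ⟨r, ⟨c, hc⟩⟩

open Classical in
theorem coinv_eq_sum {lam : FixedPartition m} {mu : FixedPartition m'} (T : lam.Cell → Fin N)
    (U : mu.Cell → Fin N) :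
    coinv T U = ∑ v : lam.Cell, (Finset.univ.filter fun r : Fin m' =>
      ∃ c : ℕ, c + v.1 = v.2 + r ∧ Encloses U r c (T v)).card := by
  let P : lam.Cell × Fin m' → Prop := fun q =>
    ∃ c : ℕ, c + q.1.1 = q.1.2 + q.2 ∧ Encloses U q.2 c (T q.1)
  let f : {τ : LLTTriple lam mu // τ.IsCoinversion T U} → {q // P q} := fun τ =>
    ⟨(τ.1.v, τ.1.row), τ.1.col, by have := τ.1.content_eq; simp only; omega,
      Nat.lt_succ_iff.1 τ.1.col.2, τ.2.1, τ.2.2⟩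
  have hf : Function.Bijective f := by
    constructor
    · rintro ⟨⟨v, r, c, hc⟩, hτ⟩ ⟨⟨v', r', c', hc'⟩, hτ'⟩ h
      simp only [f, Subtype.mk.injEq, Prod.mk.injEq] at h
      obtain ⟨rfl, rfl⟩ := h
      obtain rfl : c = c' := Fin.ext (by omega)
      rfl
    · rintro ⟨⟨v, r⟩, c, hc, hle, h1, h2⟩
      exact ⟨⟨⟨v, r, ⟨c, Nat.lt_succ_iff.2 hle⟩, by simp only at hc ⊢; omega⟩, h1, h2⟩, rfl⟩
  rw [coinv, Nat.card_congr (Equiv.ofBijective f hf), Nat.card_eq_fintype_card,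
    Fintype.card_subtype, Finset.card_filter, Fintype.sum_prod_type]
  simp only [Finset.card_filter, P]

theorem encloses_extend_castSucc {mu' mu : FixedPartition m'} (h : Interlaces mu' mu)
    (U : mu'.Cell → Fin N) (r : Fin m') (c : ℕ) (b : Fin N) :
    Encloses (extend mu' mu U) r c b.castSucc ↔ Encloses U r c b := by
  have hval : ∀ (c : ℕ) (hc : c < mu.parts r) (hc' : c < mu'.parts r),
      extend mu' mu U ⟨r, ⟨c, hc⟩⟩ = (U ⟨r, ⟨c, hc'⟩⟩).castSucc := fun c hc hc' => dif_pos hc'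
  constructor
  · rintro ⟨h0, h1, h2⟩
    have hle : c ≤ mu'.parts r := by
      rcases c with _ | c
      · exact Nat.zero_le _
      · by_contra hlt
        have := h1 c h0 rfl
        rw [extend_eq_last_iff.2 (by simp only; omega)] at this
        exact absurd (Fin.castSucc_lt_last b) (not_lt.2 this)
    refine ⟨hle, fun c' hc' hcc => ?_, fun hc => ?_⟩
    · have := h1 c' (hc'.trans_le (h.1 r)) hcc
      rwa [hval _ _ hc', Fin.castSucc_le_castSucc_iff] at this
    · have := h2 (hc.trans_le (h.1 r))
      rwa [hval _ _ hc, Fin.castSucc_le_castSucc_iff] at this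
  · rintro ⟨h0, h1, h2⟩
    refine ⟨h0.trans (h.1 r), fun c' hc' hcc => ?_, fun hc => ?_⟩
    · have hlt : c' < mu'.parts r := by omega
      rw [hval _ _ hlt, Fin.castSucc_le_castSucc_iff]
      exact h1 c' hlt hcc
    · by_cases hlt : c < mu'.parts r
      · rw [hval _ _ hlt, Fin.castSucc_le_castSucc_iff]
        exact h2 hlt
      · rw [extend_eq_last_iff.2 (not_lt.1 hlt)]
        exact Fin.le_last _

theorem encloses_extend_last {mu' mu : FixedPartition m'} (h : Interlaces mu' mu)
    (U : mu'.Cell → Fin N) (r : Fin m') (c : ℕ) :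
    Encloses (extend mu' mu U) r c (Fin.last N) ↔ mu'.parts r ≤ c ∧ c ≤ mu.parts r := by
  constructor
  · rintro ⟨h0, -, h2⟩
    refine ⟨?_, h0⟩
    rcases h0.eq_or_lt with rfl | hlt
    · exact h.1 r
    · exact extend_eq_last_iff.1 (le_antisymm (Fin.le_last _) (h2 hlt))
  · rintro ⟨h1, h2⟩
    refine ⟨h2, fun _ _ _ => Fin.le_last _, fun hc => ?_⟩
    rw [extend_eq_last_iff.2 h1]

open Classical in
theorem card_filter_strip {mu' mu : FixedPartition m} (h : Interlaces mu' mu) (i : Fin m) (j : ℕ) :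
    (Finset.univ.filter fun r : Fin m => ∃ c : ℕ, c + i = j + r ∧
      (mu'.parts r ≤ c ∧ c ≤ mu.parts r)).card =
    (edge mu' mu (j + (m - 1 - i)) || mu'.occ (j + (m - 1 - i))).toNat := by
  set p := j + (m - 1 - i) with hp
  have hmem : ∀ r : Fin m, (∃ c : ℕ, c + i = j + r ∧ (mu'.parts r ≤ c ∧ c ≤ mu.parts r)) ↔
      mu'.pos r ≤ p ∧ p ≤ mu.pos r := by
    intro r
    have := r.2
    have := i.2
    simp only [pos, hp]
    constructor
    · rintro ⟨c, h1, h2, h3⟩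
      omega
    · rintro ⟨h1, h2⟩
      exact ⟨j + (m - 1 - i) - (m - 1 - r), by omega, by omega, by omega⟩
  simp only [hmem]
  by_cases hex : ∃ r, mu'.pos r ≤ p ∧ p ≤ mu.pos r
  · obtain ⟨r, hr⟩ := hex
    have h1 : (Finset.univ.filter fun r => mu'.pos r ≤ p ∧ p ≤ mu.pos r) = {r} := by
      ext r'
      simp only [Finset.mem_filter, Finset.mem_univ, true_and, Finset.mem_singleton]
      refine ⟨fun hr' => ?_, fun hr' => hr' ▸ hr⟩
      rcases lt_trichotomy r r' with hlt | rfl | hlt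
      · have := h.pos_lt hlt
        omega
      · rfl
      · have := h.pos_lt hlt
        omega
    have h2 : (edge mu' mu p || mu'.occ p) = true := by
      rw [Bool.or_eq_true, edge, occ, decide_eq_true_eq, decide_eq_true_eq]
      rcases hr.1.eq_or_lt with h' | h'
      · exact Or.inr ⟨r, h'⟩
      · exact Or.inl ⟨r, h', hr.2⟩
    rw [h1, h2]
    rfl
  · have h2 : (edge mu' mu p || mu'.occ p) = false := by
      rw [Bool.or_eq_false_iff, edge, occ, decide_eq_false_iff_not, decide_eq_false_iff_not]
      refine ⟨fun ⟨r, h1, h3⟩ => hex ⟨r, h1.le, h3⟩, fun ⟨r, hr⟩ => hex ⟨r, hr.le, ?_⟩⟩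
      rw [← hr]
      exact h.pos_le r
    rw [h2, Finset.filter_false_of_mem fun r _ hr => hex ⟨r, hr⟩]
    rfl

theorem FixedPartition.Interlaces.sum_cell {lam' lam : FixedPartition m}
    (h : Interlaces lam' lam) (f : lam.Cell → ℕ) :
    ∑ v, f v = (∑ v, f (h.cellEmb v)) + ∑ v with lam'.parts v.1 ≤ v.2, f v :=
  h.prod_cell (M := Multiplicative ℕ) f

theorem coinv_extend {lam' lam mu' mu : FixedPartition m} (hl : Interlaces lam' lam)
    (hm : Interlaces mu' mu) (T : lam'.Cell → Fin N) (U : mu'.Cell → Fin N) {K : ℕ}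
    (hK : ∀ i, lam.pos i < K) :
    coinv (extend lam' lam T) (extend mu' mu U) = coinv T U +
      ∑ p : Fin K, (edge lam' lam (p + 1) && (edge mu' mu p || mu'.occ p)).toNat := by
  classical
  have h1 : ∀ p : ℕ, (edge lam' lam (p + 1) && (edge mu' mu p || mu'.occ p)).toNat =
      if edge lam' lam (p + 1) = true then (edge mu' mu p || mu'.occ p).toNat else 0 := by
    intro p
    cases edge lam' lam (p + 1) <;> simp
  simp only [h1]
  rw [hl.sum_edge hK fun p => (edge mu' mu p || mu'.occ p).toNat, coinv_eq_sum, coinv_eq_sum,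
    hl.sum_cell]
  congr 1
  · refine Finset.sum_congr rfl fun v _ => ?_
    simp only [hl.extend_cellEmb, encloses_extend_castSucc hm]
    rfl
  · refine Finset.sum_congr rfl fun v hv => ?_
    have hv' : extend lam' lam T v = Fin.last N := extend_eq_last_iff.2 (by simpa using hv)
    simp only [hv', encloses_extend_last hm]
    exact card_filter_strip hm v.1 v.2

theorem prod_X_extend {A : Type*} [CommSemiring A] {lam' lam : FixedPartition m}
    (h : Interlaces lam' lam) (T : lam'.Cell → Fin N) {K : ℕ} (hK : ∀ i, lam.pos i < K) :
    ∏ v, (MvPolynomial.X (extend lam' lam T v) : MvPolynomial (Fin (N + 1)) A) =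
      MvPolynomial.rename Fin.castSucc (∏ v, MvPolynomial.X (T v)) *
        MvPolynomial.X (Fin.last N) ^ ∑ p : Fin K, (edge lam' lam (p + 1)).toNat := by
  have h1 : ∀ p : ℕ, (edge lam' lam (p + 1)).toNat =
      if edge lam' lam (p + 1) = true then 1 else 0 := by
    intro p
    cases edge lam' lam (p + 1) <;> simp
  simp only [h1]
  rw [h.sum_edge hK fun _ => 1, h.prod_cell, map_prod, Finset.sum_const, smul_eq_mul, mul_one]
  congr 1
  · refine Finset.prod_congr rfl fun v _ => ?_
    rw [h.extend_cellEmb, MvPolynomial.rename_X]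
  · refine Finset.prod_eq_pow_card fun v hv => ?_
    rw [extend_eq_last_iff.2 (by simpa using hv)]

/-- Splitting off the largest letter. -/
theorem LLT_succ (N : ℕ) {lam mu : FixedPartition m} {K : ℕ} (hlam : ∀ i, lam.pos i < K)
    (hmu : ∀ i, mu.pos i < K) :
    LLT (N + 1) lam mu = ∑ lam' ∈ lam.stripped, ∑ mu' ∈ mu.stripped,
      MvPolynomial.rename Fin.castSucc (LLT N lam' mu') *
        stripWeight (MvPolynomial.X (Fin.last N)) (MvPolynomial.C Polynomial.X) K
          lam' lam mu' mu := by
  rw [LLT, sum_ssyt_succ]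
  refine Finset.sum_congr rfl fun lam' hl => ?_
  simp only [sum_ssyt_succ mu]
  rw [Finset.sum_comm]
  refine Finset.sum_congr rfl fun mu' hm => ?_
  rw [mem_stripped] at hl hm
  rw [LLT, map_sum, Finset.sum_mul]
  refine Finset.sum_congr rfl fun T _ => ?_
  rw [map_sum, Finset.sum_mul]
  refine Finset.sum_congr rfl fun U _ => ?_
  rw [coinv_extend hl hm T U hlam, prod_X_extend hl T hlam, prod_X_extend hm U hmu, stripWeight,
    Finset.prod_mul_distrib, Finset.prod_pow_eq_pow_sum, Finset.prod_pow_eq_pow_sum,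
    Finset.sum_add_distrib]
  simp only [map_mul, MvPolynomial.rename_C, map_pow, pow_add]
  ring

end

/-! ### LLT polynomials as partition functions -/

section
variable {A B : Type*} [CommRing A] [CommRing B] (φ : A →+* B)

theorem map_lax (x t : A) (s s' b b' : Occ) :
    φ (lax x t s s' b b') = lax (φ x) (φ t) s s' b b' := by
  simp only [lax]
  split_ifs <;> simp

theorem mapMatrix_rowOp (x t : A) (K : ℕ) :
    φ.mapMatrix (rowOp x t K) = rowOp (φ x) (φ t) K := by
  ext S S'
  change φ.mapMatrix (mpo (lax x t) S S') Occ.empty Occ.empty =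
    mpo (lax (φ x) (φ t)) S S' Occ.empty Occ.empty
  have h : (φ.mapMatrix ∘ fun p => lax x t (S p) (S' p)) =
      fun p => lax (φ x) (φ t) (S p) (S' p) :=
    funext fun p => Matrix.ext fun b b' => map_lax φ x t _ _ b b'
  rw [mpo, map_list_prod, List.map_ofFn, mpo, h]

theorem map_partitionFun (t : A) {N : ℕ} (x : Fin N → A) {K : ℕ} (S S' : Fin K → Occ) :
    φ (partitionFun t x S S') = partitionFun (φ t) (φ ∘ x) S S' := by
  change φ.mapMatrix (partitionFun t x) S S' = _
  have h : (φ.mapMatrix ∘ fun i => rowOp (x i) t K) = fun i => rowOp ((φ ∘ x) i) (φ t) K :=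
    funext fun i => mapMatrix_rowOp φ _ _ _
  rw [partitionFun, map_list_prod, List.map_ofFn, partitionFun, h]

end

section
variable {m : ℕ}

/-- The partition whose parts are all zero. -/
def FixedPartition.zero (m : ℕ) : FixedPartition m := ⟨fun _ => 0, fun _ _ _ => le_rfl⟩

theorem FixedPartition.zero_pos_lt {lam : FixedPartition m} {K : ℕ} (h : ∀ i, lam.pos i < K)
    (i : Fin m) : (FixedPartition.zero m).pos i < K := by
  refine lt_of_le_of_lt ?_ (h i)
  simp [pos, FixedPartition.zero]

theorem FixedPartition.eq_zero_of_isEmpty {lam : FixedPartition m} (h : IsEmpty lam.Cell) :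
    lam = FixedPartition.zero m := by
  refine parts_injective (funext fun i => ?_)
  by_contra h0
  exact h.false ⟨i, ⟨0, Nat.pos_of_ne_zero h0⟩⟩

instance : IsEmpty (FixedPartition.zero m).Cell := ⟨fun c => c.2.elim0⟩

theorem LLT_zero_zero : LLT 0 (FixedPartition.zero m) (FixedPartition.zero m) = 1 := by
  have h : (FixedPartition.zero m).ssyt 0 = {isEmptyElim} := by
    ext T
    rw [mem_ssyt, Finset.mem_singleton]
    exact ⟨fun _ => Subsingleton.elim _ _,
      fun _ => ⟨fun i j => j.elim0, fun i i' j hj => absurd hj (Nat.not_lt_zero _)⟩⟩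
  rw [LLT, h, Finset.sum_singleton, Finset.sum_singleton, coinv_eq_sum]
  simp

theorem ssyt_zero_eq_empty {lam : FixedPartition m} (h : lam ≠ FixedPartition.zero m) :
    lam.ssyt 0 = ∅ := by
  refine Finset.eq_empty_of_forall_notMem fun T _ => h (eq_zero_of_isEmpty ⟨fun c => ?_⟩)
  exact (T c).elim0

theorem LLT_eq_partitionFun (N : ℕ) {lam mu : FixedPartition m} {K : ℕ}
    (hlam : ∀ i, lam.pos i < K) (hmu : ∀ i, mu.pos i < K) :
    LLT N lam mu = partitionFun (MvPolynomial.C Polynomial.X) MvPolynomial.X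
      (pairState K (FixedPartition.zero m) (FixedPartition.zero m)) (pairState K lam mu) := by
  induction N generalizing lam mu with
  | zero =>
    rw [partitionFun, List.ofFn_zero, List.prod_nil, Matrix.one_apply]
    split_ifs with h
    · obtain ⟨rfl, rfl⟩ := pairState_injective (zero_pos_lt hlam) (zero_pos_lt hmu) hlam hmu h
      exact LLT_zero_zero
    · by_cases h1 : lam = FixedPartition.zero m
      · have h2 : mu ≠ FixedPartition.zero m := fun h2 => h (by rw [h1, h2])
        simp [LLT, ssyt_zero_eq_empty h2]
      · simp [LLT, ssyt_zero_eq_empty h1]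
  | succ N ih =>
    rw [partitionFun_succ, sum_mul_rowOp _ _ hlam hmu, LLT_succ N hlam hmu]
    refine Finset.sum_congr rfl fun lam' hl => Finset.sum_congr rfl fun mu' hm => ?_
    rw [mem_stripped] at hl hm
    rw [ih (hl.pos_lt_of_pos_lt hlam) (hm.pos_lt_of_pos_lt hmu)]
    congr 1
    refine (map_partitionFun (MvPolynomial.rename (R := ℤ[X]) (Fin.castSucc (n := N))).toRingHom
      _ _ _ _).trans ?_
    congr 1
    · exact MvPolynomial.rename_C _ _
    · funext i
      exact MvPolynomial.rename_X _ _

theorem exists_pos_bound (lam : FixedPartition m) : ∃ K, ∀ i, lam.pos i < K :=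
  ⟨Finset.univ.sup lam.pos + 1, fun i => Nat.lt_succ_of_le (Finset.le_sup (Finset.mem_univ i))⟩

theorem LLT_isSymmetric (N : ℕ) (lam mu : FixedPartition m) : (LLT N lam mu).IsSymmetric := by
  intro e
  obtain ⟨K₁, h₁⟩ := exists_pos_bound lam
  obtain ⟨K₂, h₂⟩ := exists_pos_bound mu
  rw [LLT_eq_partitionFun N (fun i => (h₁ i).trans_le (le_max_left K₁ K₂))
    (fun i => (h₂ i).trans_le (le_max_right K₁ K₂))]
  refine (map_partitionFun (MvPolynomial.rename (R := ℤ[X]) e).toRingHom _ _ _ _).trans ?_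
  rw [← partitionFun_perm (MvPolynomial.C Polynomial.X) (x := MvPolynomial.X)
    (fun i => MvPolynomial.X_ne_zero i)
    (by rw [Ne, MvPolynomial.C_eq_zero]; exact Polynomial.X_ne_zero) e]
  congr 1
  · exact MvPolynomial.rename_C _ _
  · funext i
    exact MvPolynomial.rename_X _ _

end

/-! ### The linear relations between the LLT polynomials of a family -/

section
variable {n : ℕ} {β : Fin (2 * n) → ℕ}

theorem sub_le_of_strictAnti {k : ℕ} {f : Fin k → ℕ} (hf : StrictAnti f) (i : Fin k) :
    k - 1 - i ≤ f i := by
  have : ∀ (d : ℕ) (i : Fin k), k - 1 - i = d → d ≤ f i := by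
    intro d
    induction d with
    | zero => intro i _; exact Nat.zero_le _
    | succ d ih =>
      intro i hi
      have h1 := ih ⟨i + 1, by omega⟩ (by simp only; omega)
      have h2 : f ⟨i + 1, by omega⟩ < f i := hf (by simp [Fin.lt_def])
      omega
  exact this _ i rfl

theorem famPart_pos (hβ : StrictAnti β) (S : HalfSubset n) (k : Fin n) :
    (famPart β hβ S).pos k = β (S.1.orderEmbOfFin S.2 k) := by
  have h : StrictAnti fun k => β (S.1.orderEmbOfFin S.2 k) :=
    fun _ _ h => hβ ((S.1.orderEmbOfFin S.2).strictMono h)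
  have h1 := sub_le_of_strictAnti h k
  have := k.2
  simp only [pos, famPart]
  omega

theorem famPart_occ (hβ : StrictAnti β) (S : HalfSubset n) (p : ℕ) :
    (famPart β hβ S).occ p = decide (∃ i, β i = p ∧ i ∈ S.1) := by
  rw [occ]
  congr 1
  simp only [famPart_pos, eq_iff_iff]
  constructor
  · rintro ⟨k, hk⟩
    exact ⟨_, hk, Finset.orderEmbOfFin_mem _ _ _⟩
  · rintro ⟨i, hi, hS⟩
    rw [← Finset.mem_coe, ← Finset.range_orderEmbOfFin S.1 S.2] at hS
    obtain ⟨k, rfl⟩ := hS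
    exact ⟨k, hi⟩

/-- The state with particles at the sites `β i`, of the first colour where `z i` is true. -/
def wordState (K : ℕ) (β : Fin (2 * n) → ℕ) (z : Fin (2 * n) → Bool) : Fin K → Occ := fun p =>
  (decide (∃ i, β i = p ∧ z i = true), decide (∃ i, β i = p ∧ z i = false))

theorem pairState_famPart (hβ : StrictAnti β) (K : ℕ) (S : HalfSubset n) :
    pairState K (famPart β hβ S) (famPart β hβ S.compl) =
      wordState K β fun i => decide (i ∈ S.1) := by
  funext p
  simp [pairState, wordState, famPart_occ, HalfSubset.compl]

theorem wordState_apply {K : ℕ} (hinj : Function.Injective β) (z : Fin (2 * n) → Bool)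
    {p : Fin K} {i : Fin (2 * n)} (hp : (p : ℕ) = β i) :
    wordState K β z p = (z i, !z i) := by
  have h : ∀ b, (∃ j, β j = p ∧ z j = b) ↔ z i = b := fun b =>
    ⟨fun ⟨j, hj, hz⟩ => by rw [← hinj (hj.trans hp), hz], fun hz => ⟨i, hp.symm, hz⟩⟩
  simp only [wordState, h]
  cases z i <;> rfl

theorem wordState_eq_empty {K : ℕ} (z : Fin (2 * n) → Bool) {p : Fin K} (hp : ∀ i, β i ≠ p) :
    wordState K β z p = Occ.empty := by
  simp [wordState, hp]

theorem update_wordState {K : ℕ} (hinj : Function.Injective β) (z : Fin (2 * n) → Bool)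
    {p : Fin K} {i : Fin (2 * n)} (hp : (p : ℕ) = β i) :
    Function.update (wordState K β z) p (false, true) =
      wordState K β (Function.update z i false) := by
  funext q
  by_cases hq : ∃ j, β j = q
  · obtain ⟨j, hj⟩ := hq
    rw [wordState_apply hinj _ hj.symm]
    by_cases hij : j = i
    · have : q = p := Fin.ext (by rw [hp, ← hj, hij])
      simp [this, hij]
    · have : q ≠ p := fun h => hij (hinj (by rw [hj, h, hp]))
      rw [Function.update_of_ne this, Function.update_of_ne hij, wordState_apply hinj _ hj.symm]
  · push Not at hq
    have : q ≠ p := fun h => hq i (by rw [h, hp])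
    rw [Function.update_of_ne this, wordState_eq_empty _ hq, wordState_eq_empty _ hq]

/-- The factor of the raising operator for a letter of a word. -/
def letterFactor {A : Type*} [CommRing A] (t : A) (b : Bool) : A := if b then -t else -1

/-- The raising operator on functions on words. -/
def raiseFun {A : Type*} [CommRing A] (t : A) {k : ℕ} (f : (Fin k → Bool) → A)
    (z : Fin k → Bool) : A :=
  ∑ i, if z i = true then
    (∏ j, if i < j then letterFactor t (z j) else 1) * f (Function.update z i false) else 0

theorem cartan_letter {A : Type*} [CommRing A] (t : A) (b : Bool) :
    cartan t (b, !b) = letterFactor t b := by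
  cases b <;> simp [cartan, cartanMon, letterFactor, MonList.eval]

theorem cartan_empty {A : Type*} [CommRing A] (t : A) : cartan t Occ.empty = 1 := by
  simp [cartan, cartanMon, MonList.eval]

theorem raiseFun_partitionFun (hβ : StrictAnti β) {A : Type*} [CommRing A] (t : A) {N : ℕ}
    (x : Fin N → A) {K : ℕ} (hK : ∀ i, β i < K) {S₀ : Fin K → Occ} (hS₀ : ColorBalanced S₀)
    (z : Fin (2 * n) → Bool) :
    raiseFun t (fun z => partitionFun t x S₀ (wordState K β z)) z = 0 := by
  have hinj := hβ.injective
  let b : Fin (2 * n) ↪ Fin K := ⟨fun i => ⟨β i, hK i⟩, fun i j h => hinj (by simpa using h)⟩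
  rw [← sum_cartan_partitionFun_eq_zero t x hS₀ (wordState K β z), raiseFun]
  trans ∑ p ∈ Finset.univ.map b, if wordState K β z p = (true, false) then
      (∏ q, if q < p then cartan t (wordState K β z q) else 1) *
      partitionFun t x S₀ (Function.update (wordState K β z) p (false, true)) else 0
  · rw [Finset.sum_map]
    refine Finset.sum_congr rfl fun i _ => ?_
    rw [wordState_apply hinj z (p := b i) (i := i) rfl]
    have h1 : ((z i, !z i) = (true, false)) ↔ z i = true := by cases z i <;> simp
    simp only [h1]
    refine if_congr Iff.rfl ?_ rfl
    rw [update_wordState hinj z (p := b i) (i := i) rfl]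
    congr 1
    rw [← Finset.prod_subset (Finset.subset_univ (Finset.univ.map b)), Finset.prod_map]
    · refine Finset.prod_congr rfl fun j _ => ?_
      rw [wordState_apply hinj z (p := b j) (i := j) rfl, cartan_letter]
      refine if_congr ?_ rfl rfl
      change i < j ↔ β j < β i
      exact hβ.lt_iff_gt.symm
    · intro q _ hq
      rw [wordState_eq_empty, cartan_empty, ite_self]
      intro j hj
      exact hq (Finset.mem_map.2 ⟨j, Finset.mem_univ _, Fin.ext hj⟩)
  · refine Finset.sum_subset (Finset.subset_univ _) fun q _ hq => ?_
    rw [wordState_eq_empty, if_neg (by simp [Occ.empty])]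
    intro j hj
    exact hq (Finset.mem_map.2 ⟨j, Finset.mem_univ _, Fin.ext hj⟩)

theorem colorBalanced_pairState (K : ℕ) {m : ℕ} (lam : FixedPartition m) :
    ColorBalanced (pairState K lam lam) := fun _ => rfl

end

/-! ### Highest weight vectors -/

section
variable {A : Type*} [CommRing A] (t : A) {k : ℕ}

/-- The number of letters `true` of a word. -/
def trueCount (z : Fin k → Bool) : ℕ := ∑ i, (z i).toNat

theorem trueCount_cons (b : Bool) (z : Fin k → Bool) :
    trueCount (Fin.cons b z : Fin (k + 1) → Bool) = b.toNat + trueCount z := by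
  simp [trueCount, Fin.sum_univ_succ]

theorem trueCount_le (z : Fin k → Bool) : trueCount z ≤ k := by
  calc trueCount z ≤ ∑ _i : Fin k, 1 := Finset.sum_le_sum fun i _ => Bool.toNat_le _
    _ = k := by simp

/-- The product of the factors of all letters of a word. -/
def wordFactor (z : Fin k → Bool) : A := ∏ j, letterFactor t (z j)

theorem wordFactor_cons (b : Bool) (z : Fin k → Bool) :
    wordFactor t (Fin.cons b z : Fin (k + 1) → Bool) = letterFactor t b * wordFactor t z := by
  simp [wordFactor, Fin.prod_univ_succ]

theorem wordFactor_eq (z : Fin k → Bool) : wordFactor t z = (-1) ^ k * t ^ trueCount z := by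
  have h : ∀ b, letterFactor t b = -1 * t ^ b.toNat := by
    rintro (_ | _) <;> simp [letterFactor]
  simp [wordFactor, h, trueCount, Finset.prod_mul_distrib, Finset.prod_pow_eq_pow_sum,
    -neg_mul, -one_mul]

theorem raiseFun_cons_true (f : (Fin (k + 1) → Bool) → A) (z : Fin k → Bool) :
    raiseFun t f (Fin.cons true z) =
      raiseFun t (fun z => f (Fin.cons true z)) z + wordFactor t z * f (Fin.cons false z) := by
  simp [raiseFun, Fin.sum_univ_succ, Fin.prod_univ_succ, wordFactor, ← Fin.cons_update, add_comm]

theorem raiseFun_cons_false (f : (Fin (k + 1) → Bool) → A) (z : Fin k → Bool) :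
    raiseFun t f (Fin.cons false z) = raiseFun t (fun z => f (Fin.cons false z)) z := by
  simp [raiseFun, Fin.sum_univ_succ, Fin.prod_univ_succ, ← Fin.cons_update]

theorem raiseFun_add (f g : (Fin k → Bool) → A) :
    raiseFun t (f + g) = raiseFun t f + raiseFun t g := by
  funext z
  simp only [raiseFun, Pi.add_apply, ← Finset.sum_add_distrib]
  refine Finset.sum_congr rfl fun i _ => ?_
  split_ifs <;> ring

theorem raiseFun_smul (a : A) (f : (Fin k → Bool) → A) :
    raiseFun t (a • f) = a • raiseFun t f := by
  funext z
  simp only [raiseFun, Pi.smul_apply, smul_eq_mul, Finset.mul_sum]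
  refine Finset.sum_congr rfl fun i _ => ?_
  split_ifs <;> ring

theorem raiseFun_zero : raiseFun t (0 : (Fin k → Bool) → A) = 0 := by
  simpa using raiseFun_smul t (0 : A) (0 : (Fin k → Bool) → A)

/-- The lowering operator on functions on words. -/
def lowerFun : {k : ℕ} → ((Fin k → Bool) → A) → (Fin k → Bool) → A
  | 0, _, _ => 0
  | k + 1, f, z =>
    if z 0 = true then -lowerFun (k := k) (fun z => f (Fin.cons true z)) (Fin.tail z)
    else -t * lowerFun (k := k) (fun z => f (Fin.cons false z)) (Fin.tail z) +
      f (Fin.cons true (Fin.tail z))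

theorem lowerFun_cons_true (f : (Fin (k + 1) → Bool) → A) (z : Fin k → Bool) :
    lowerFun t f (Fin.cons true z) = -lowerFun t (fun z => f (Fin.cons true z)) z := by
  simp [lowerFun]

theorem lowerFun_cons_false (f : (Fin (k + 1) → Bool) → A) (z : Fin k → Bool) :
    lowerFun t f (Fin.cons false z) =
      -t * lowerFun t (fun z => f (Fin.cons false z)) z + f (Fin.cons true z) := by
  simp [lowerFun]

theorem forall_fin_cons {P : (Fin (k + 1) → Bool) → Prop} :
    (∀ z, P z) ↔ ∀ b (z : Fin k → Bool), P (Fin.cons b z) :=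
  ⟨fun h _ _ => h _, fun h z => by rw [← Fin.cons_self_tail z]; exact h _ _⟩

theorem lowerFun_add (f g : (Fin k → Bool) → A) :
    lowerFun t (f + g) = lowerFun t f + lowerFun t g := by
  funext z
  induction k with
  | zero => simp [lowerFun]
  | succ k ih =>
    revert z
    rw [forall_fin_cons]
    rintro (_ | _) z
    · have := ih (fun z => f (Fin.cons false z)) (fun z => g (Fin.cons false z)) z
      simp only [Pi.add_apply, lowerFun_cons_false] at this ⊢
      rw [show (fun z : Fin k → Bool => f (Fin.cons false z) + g (Fin.cons false z)) =
        (fun z => f (Fin.cons false z)) + fun z => g (Fin.cons false z) from rfl, this]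
      ring
    · have := ih (fun z => f (Fin.cons true z)) (fun z => g (Fin.cons true z)) z
      simp only [Pi.add_apply, lowerFun_cons_true] at this ⊢
      rw [show (fun z : Fin k → Bool => f (Fin.cons true z) + g (Fin.cons true z)) =
        (fun z => f (Fin.cons true z)) + fun z => g (Fin.cons true z) from rfl, this]
      ring

theorem lowerFun_smul (a : A) (f : (Fin k → Bool) → A) :
    lowerFun t (a • f) = a • lowerFun t f := by
  funext z
  induction k with
  | zero => simp [lowerFun]
  | succ k ih =>
    revert z
    rw [forall_fin_cons]
    rintro (_ | _) z
    · have := ih (fun z => f (Fin.cons false z)) z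
      simp only [Pi.smul_apply, lowerFun_cons_false, smul_eq_mul] at this ⊢
      rw [show (fun z : Fin k → Bool => a * f (Fin.cons false z)) =
        a • fun z => f (Fin.cons false z) from rfl, this]
      ring
    · have := ih (fun z => f (Fin.cons true z)) z
      simp only [Pi.smul_apply, lowerFun_cons_true, smul_eq_mul] at this ⊢
      rw [show (fun z : Fin k → Bool => a * f (Fin.cons true z)) =
        a • fun z => f (Fin.cons true z) from rfl, this]
      ring

theorem lowerFun_zero : lowerFun t (0 : (Fin k → Bool) → A) = 0 := by
  simpa using lowerFun_smul t (0 : A) (0 : (Fin k → Bool) → A)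

theorem lowerFun_wordFactor_mul (f : (Fin k → Bool) → A) (z : Fin k → Bool) :
    lowerFun t (fun z => wordFactor t z * f z) z = t * wordFactor t z * lowerFun t f z := by
  induction k with
  | zero => simp [lowerFun]
  | succ k ih =>
    revert z
    rw [forall_fin_cons]
    rintro (_ | _) z
    · simp only [lowerFun_cons_false, wordFactor_cons, mul_assoc]
      have := congrFun (lowerFun_smul t (letterFactor t false)
        fun z => wordFactor t z * f (Fin.cons false z)) z
      simp only [Pi.smul_def, smul_eq_mul] at this
      rw [this, ih fun z => f (Fin.cons false z)]
      simp only [letterFactor, Bool.false_eq_true, if_false, if_true]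
      ring
    · simp only [lowerFun_cons_true, wordFactor_cons, mul_assoc]
      have := congrFun (lowerFun_smul t (letterFactor t true)
        fun z => wordFactor t z * f (Fin.cons true z)) z
      simp only [Pi.smul_def, smul_eq_mul] at this
      rw [this, ih fun z => f (Fin.cons true z)]
      simp only [letterFactor, if_true]
      ring

/-- The eigenvalue of the commutator of the raising and the lowering operator on words of length
`k` with `c` letters `true`. -/
def weightEigenvalue (k c : ℕ) : A :=
  (-1) ^ (k + 1) * (∑ i ∈ Finset.range c, t ^ i - ∑ i ∈ Finset.range (k - c), t ^ i)

theorem raiseFun_lowerFun (f : (Fin k → Bool) → A) (z : Fin k → Bool) :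
    raiseFun t (lowerFun t f) z =
      lowerFun t (raiseFun t f) z + weightEigenvalue t k (trueCount z) * f z := by
  induction k with
  | zero => simp [lowerFun, raiseFun, weightEigenvalue, trueCount]
  | succ k ih =>
    revert z
    rw [forall_fin_cons]
    have hgeom : ∀ m, ∑ i ∈ Finset.range (m + 1), t ^ i = t * ∑ i ∈ Finset.range m, t ^ i + 1 := by
      intro m
      rw [Finset.sum_range_succ', Finset.mul_sum]
      simp [pow_succ']
    rintro (_ | _) z
    · have hsub : k + 1 - trueCount z = k - trueCount z + 1 := by
        have := trueCount_le z
        omega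
      have h1 : (fun z => lowerFun t f (Fin.cons false z)) =
          (-t) • lowerFun t (fun z => f (Fin.cons false z)) + fun z => f (Fin.cons true z) := by
        funext z
        rw [lowerFun_cons_false]
        rfl
      rw [raiseFun_cons_false, h1, raiseFun_add, raiseFun_smul, lowerFun_cons_false]
      simp only [Pi.add_apply, Pi.smul_apply, smul_eq_mul, raiseFun_cons_true, raiseFun_cons_false]
      rw [ih (fun z => f (Fin.cons false z)), wordFactor_eq, trueCount_cons]
      have hg : t ^ trueCount z = t * ∑ i ∈ Finset.range (trueCount z), t ^ i + 1 -
          ∑ i ∈ Finset.range (trueCount z), t ^ i := by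
        rw [← hgeom, Finset.sum_range_succ]
        ring
      simp only [weightEigenvalue, Bool.toNat_false, zero_add, hsub, hgeom (k - _), hg, pow_succ]
      ring
    · have h1 : (fun z => lowerFun t f (Fin.cons true z)) =
          (-1 : A) • lowerFun t (fun z => f (Fin.cons true z)) := by
        funext z
        rw [lowerFun_cons_true]
        simp
      have h2 : (fun z => raiseFun t f (Fin.cons true z)) =
          raiseFun t (fun z => f (Fin.cons true z)) +
            fun z => wordFactor t z * f (Fin.cons false z) := by
        funext z
        rw [raiseFun_cons_true]
        rfl
      rw [raiseFun_cons_true, h1, raiseFun_smul, lowerFun_cons_true, h2, lowerFun_add,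
        lowerFun_cons_false]
      simp only [Pi.add_apply, Pi.smul_apply, smul_eq_mul]
      rw [lowerFun_wordFactor_mul, ih (fun z => f (Fin.cons true z)), wordFactor_eq,
        trueCount_cons]
      simp only [weightEigenvalue, Bool.toNat_true, add_comm 1,
        Nat.add_sub_add_right, Finset.sum_range_succ, pow_succ]
      ring

/-- The function vanishes off the words with `p - j` letters `true`. -/
def SupportedAt (f : (Fin k → Bool) → A) (j p : ℕ) : Prop := ∀ z, trueCount z + j ≠ p → f z = 0

theorem SupportedAt.lowerFun {f : (Fin k → Bool) → A} {j p : ℕ} (h : SupportedAt f j p) :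
    SupportedAt (lowerFun t f) (j + 1) p := by
  induction k generalizing j p with
  | zero => intro z _; rfl
  | succ k ih =>
    unfold SupportedAt
    rw [forall_fin_cons]
    rintro (_ | _) z hz <;> rw [trueCount_cons] at hz
    · simp only [Bool.toNat_false, zero_add] at hz
      have h1 : SupportedAt (fun z => f (Fin.cons false z)) j p := fun z hz =>
        h _ (by rw [trueCount_cons]; simpa using hz)
      rw [lowerFun_cons_false, ih h1 z hz, h _ (by rw [trueCount_cons]; simp; omega)]
      simp
    · simp only [Bool.toNat_true] at hz
      have h1 : SupportedAt (fun z => f (Fin.cons true z)) (j + 1) p := fun z hz =>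
        h _ (by rw [trueCount_cons]; simp; omega)
      rw [lowerFun_cons_true, ih h1 z (by omega), neg_zero]

/-- The raising operator is injective on negative weights. -/
theorem eq_zero_of_raiseFun_eq_zero [IsDomain A] (φ : A →+* ℤ) (hφ : φ t = 1) {p : ℕ}
    (hp : 2 * p < k) {f : (Fin k → Bool) → A} (hf : SupportedAt f 0 p) (h : raiseFun t f = 0) :
    f = 0 := by
  set g : ℕ → (Fin k → Bool) → A := fun j => (lowerFun t)^[j] f with hg
  have hsucc : ∀ j, g (j + 1) = lowerFun t (g j) := fun j => Function.iterate_succ_apply' _ _ _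
  have hsupp : ∀ j, SupportedAt (g j) j p := by
    intro j
    induction j with
    | zero => exact hf
    | succ j ih => rw [hsucc]; exact ih.lowerFun t
  set c : ℕ → A := fun j => ∑ i ∈ Finset.range (j + 1), weightEigenvalue t k (p - i) with hc
  have hdiag : ∀ j, raiseFun t (g (j + 1)) =
      lowerFun t (raiseFun t (g j)) + weightEigenvalue t k (p - j) • g j := by
    intro j
    funext z
    rw [hsucc, raiseFun_lowerFun]
    by_cases hz : trueCount z + j = p
    · rw [show trueCount z = p - j by omega]
      rfl
    · simp [hsupp j z hz]
  have hraise : ∀ j, raiseFun t (g (j + 1)) = c j • g j := by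
    intro j
    induction j with
    | zero =>
      rw [hdiag, show g 0 = f from rfl, h, lowerFun_zero, zero_add]
      simp [hc]
    | succ j ih =>
      rw [hdiag, ih, lowerFun_smul, ← hsucc, ← add_smul]
      simp only [hc]
      rw [← Finset.sum_range_succ]
  have hcne : ∀ j ≤ p, c j ≠ 0 := by
    intro j hj h0
    have h1 : φ (c j) = (-1) ^ (k + 1) *
        ∑ i ∈ Finset.range (j + 1), (((p - i : ℕ) : ℤ) - ((k - (p - i) : ℕ) : ℤ)) := by
      simp only [hc, map_sum, Finset.mul_sum]
      simp [weightEigenvalue, hφ]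
    rw [h0, map_zero, eq_comm] at h1
    have h2 := (mul_eq_zero.1 h1).resolve_left (pow_ne_zero _ (by norm_num))
    have h3 : ∑ i ∈ Finset.range (j + 1), (((p - i : ℕ) : ℤ) - ((k - (p - i) : ℕ) : ℤ)) < 0 :=
      Finset.sum_neg (fun i _ => by omega) ⟨0, by simp⟩
    omega
  have hdesc : ∀ d ≤ p + 1, g (p + 1 - d) = 0 := by
    intro d
    induction d with
    | zero =>
      intro _
      funext z
      exact hsupp _ z (by omega)
    | succ d ih =>
      intro hd
      have h1 := hraise (p - d)
      rw [show p - d + 1 = p + 1 - d by omega, ih (by omega), raiseFun_zero] at h1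
      rw [show p + 1 - (d + 1) = p - d by omega]
      funext z
      have h2 := congrFun h1 z
      simp only [Pi.zero_apply, Pi.smul_apply, smul_eq_mul] at h2
      exact (mul_eq_zero.1 h2.symm).resolve_left (hcne _ (by omega))
  have := hdesc (p + 1) le_rfl
  rwa [Nat.sub_self] at this

/-- No suffix of the word has more letters `false` than letters `true`. -/
def SuffixBallot : {k : ℕ} → (Fin k → Bool) → Prop
  | 0, _ => True
  | k + 1, z => SuffixBallot (k := k) (Fin.tail z) ∧ k + 1 ≤ 2 * trueCount z

theorem SuffixBallot.le {z : Fin k → Bool} (h : SuffixBallot z) : k ≤ 2 * trueCount z := by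
  cases k with
  | zero => exact Nat.zero_le _
  | succ k => exact h.2

/-- A highest weight vector is determined by its values on ballot words. -/
theorem eq_zero_of_suffixBallot [IsDomain A] (φ : A →+* ℤ) (hφ : φ t = 1) {p : ℕ}
    {f : (Fin k → Bool) → A} (hf : SupportedAt f 0 p) (h : raiseFun t f = 0)
    (hz : ∀ z, SuffixBallot z → f z = 0) : f = 0 := by
  induction k generalizing p with
  | zero => exact funext fun z => hz z trivial
  | succ k ih =>
    by_cases hp : 2 * p < k + 1
    · exact eq_zero_of_raiseFun_eq_zero t φ hφ hp hf h
    have h1 : (fun z => f (Fin.cons false z)) = 0 := by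
      refine ih (p := p) (fun z hz => hf _ (by rw [trueCount_cons]; simpa using hz))
        (funext fun z => ?_) fun z hb => ?_
      · rw [← raiseFun_cons_false, h]
        rfl
      · by_cases hc : trueCount z = p
        · refine hz _ ⟨by simpa using hb, ?_⟩
          rw [trueCount_cons, hc]
          simp
          omega
        · exact hf _ (by rw [trueCount_cons]; simpa using hc)
    have h2 : (fun z => f (Fin.cons true z)) = 0 := by
      refine ih (p := p - 1) (fun z hz => hf _ (by rw [trueCount_cons]; simp; omega))
        (funext fun z => ?_) fun z hb => hz _ ⟨by simpa using hb, ?_⟩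
      · have h3 := raiseFun_cons_true t f z
        rw [h, congrFun h1 z] at h3
        simpa using h3.symm
      · have := hb.le
        rw [trueCount_cons]
        simp
        omega
    funext z
    revert z
    rw [forall_fin_cons]
    rintro (_ | _) z
    · exact congrFun h1 z
    · exact congrFun h2 z

end

/-! ### Non-crossing matchings and ballot words -/

section
variable {k n : ℕ}

/-- The height after `m` steps of the path that goes down at the letters `true` and up at the
letters `false`. -/
def height (z : Fin k → Bool) (m : ℕ) : ℤ :=
  ∑ i : Fin k, if (i : ℕ) < m then (if z i = true then -1 else 1) else 0

theorem height_zero (z : Fin k → Bool) : height z 0 = 0 := by simp [height]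

theorem height_succ (z : Fin k → Bool) (i : Fin k) :
    height z (i + 1) = height z i + if z i = true then -1 else 1 := by
  have h : ∀ j : Fin k, (if (j : ℕ) < i + 1 then (if z j = true then (-1 : ℤ) else 1) else 0) =
      (if (j : ℕ) < i then (if z j = true then -1 else 1) else 0) +
        if j = i then (if z j = true then -1 else 1) else 0 := by
    intro j
    rcases lt_trichotomy j i with h | h | h
    · have h' : (j : ℕ) < i := h
      simp [h', h.ne, h'.trans (Nat.lt_succ_self _)]
    · simp [h]
    · have h' : (i : ℕ) < j := h
      simp [h.ne', show ¬ (j : ℕ) < i + 1 by omega, show ¬ (j : ℕ) < i by omega]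
  simp only [height, h, Finset.sum_add_distrib, Finset.sum_ite_eq', Finset.mem_univ, if_true]

theorem height_cons (b : Bool) (z : Fin k → Bool) (m : ℕ) :
    height (Fin.cons b z : Fin (k + 1) → Bool) (m + 1) =
      (if b = true then -1 else 1) + height z m := by
  simp [height, Fin.sum_univ_succ]

theorem height_self (z : Fin k → Bool) : height z k = k - 2 * trueCount z := by
  have h : ∀ i : Fin k, (if (i : ℕ) < k then (if z i = true then (-1 : ℤ) else 1) else 0) =
      1 - 2 * ((z i).toNat : ℤ) := by
    intro i
    cases z i <;> simp
  simp only [height, h, Finset.sum_sub_distrib, ← Finset.mul_sum, trueCount]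
  simp

theorem SuffixBallot.height_le {z : Fin k → Bool} (h : SuffixBallot z) {m : ℕ} (hm : m ≤ k) :
    height z k ≤ height z m := by
  induction k generalizing m with
  | zero => rw [Nat.le_zero.1 hm]
  | succ k ih =>
    cases m with
    | zero =>
      rw [height_self, height_zero]
      have := h.le
      push_cast
      omega
    | succ m =>
      obtain ⟨b, z, rfl⟩ : ∃ b w, z = Fin.cons b w := ⟨_, _, (Fin.cons_self_tail z).symm⟩
      rw [height_cons, height_cons]
      have := ih (z := z) (by simpa using h.1) (Nat.le_of_succ_le_succ hm)
      omega

namespace NoncrossingMatching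

theorem partner_injective (M : NoncrossingMatching n) : Function.Injective M.partner :=
  Function.LeftInverse.injective M.partner_partner

/-- The permutation that exchanges the end points of all arcs. -/
def partnerEquiv (M : NoncrossingMatching n) : Equiv.Perm (Fin (2 * n)) :=
  ⟨M.partner, M.partner, M.partner_partner, M.partner_partner⟩

theorem two_mul_sum (M : NoncrossingMatching n) {R : Type*} [CommRing R]
    (f : Fin (2 * n) → R) : 2 * ∑ i, f i = ∑ i, (f i + f (M.partner i)) := by
  rw [Finset.sum_add_distrib, two_mul]
  congr 1
  exact (Equiv.sum_comp M.partnerEquiv f).symm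

/-- The word marking the right end points of the arcs. -/
def rightEnds (M : NoncrossingMatching n) (i : Fin (2 * n)) : Bool := decide (M.partner i < i)

theorem rightEnds_partner (M : NoncrossingMatching n) (i : Fin (2 * n)) :
    M.rightEnds (M.partner i) = !M.rightEnds i := by
  simp only [rightEnds, M.partner_partner, ← decide_not, not_lt]
  congr 1
  exact propext ⟨le_of_lt, fun h => lt_of_le_of_ne h (M.partner_ne i).symm⟩

theorem height_rightEnds_nonneg (M : NoncrossingMatching n) (m : ℕ) :
    0 ≤ height M.rightEnds m := by
  have h : 0 ≤ 2 * height M.rightEnds m := by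
    rw [height, M.two_mul_sum]
    refine Finset.sum_nonneg fun i _ => ?_
    rw [rightEnds_partner]
    have hne := Fin.val_ne_of_ne (M.partner_ne i)
    by_cases hi : M.partner i < i
    · have hi' : (M.partner i : ℕ) < i := hi
      simp only [rightEnds, hi, decide_true, Bool.not_true, Bool.false_eq_true, if_true, if_false]
      split_ifs <;> omega
    · have hi' : ¬ (M.partner i : ℕ) < i := hi
      simp only [rightEnds, hi, decide_false, Bool.not_false, Bool.false_eq_true, if_true, if_false]
      split_ifs <;> omega
  omega

theorem height_rightEnds_self (M : NoncrossingMatching n) :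
    height M.rightEnds (2 * n) = 0 := by
  have h : 2 * height M.rightEnds (2 * n) = 0 := by
    rw [height, M.two_mul_sum]
    refine Finset.sum_eq_zero fun i _ => ?_
    rw [rightEnds_partner]
    simp only [Fin.is_lt, if_true]
    cases M.rightEnds i <;> simp
  omega

theorem rightEnds_injective : Function.Injective (rightEnds : NoncrossingMatching n → _) := by
  intro M M' h
  have hlt : ∀ i, M.partner i < i ↔ M'.partner i < i := fun i => by
    simpa [rightEnds] using congrFun h i
  have key : ∀ (M M' : NoncrossingMatching n), (∀ i, M.partner i < i ↔ M'.partner i < i) →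
      ∀ j, (∀ j' < j, M.partner j' < j' → M'.partner j' = M.partner j') →
      M.partner j < j → ¬ M.partner j < M'.partner j := by
    intro M M' hlt j ih hj hi
    have hj' := (hlt j).1 hj
    have h1 : ¬ M.partner (M'.partner j) < M'.partner j := by
      rw [hlt, M'.partner_partner]
      exact hj'.not_gt
    have h2 : M'.partner j < M.partner (M'.partner j) :=
      lt_of_le_of_ne (not_lt.1 h1) (M.partner_ne _).symm
    have h3 := M.noncrossing _ _ hi (by rwa [M.partner_partner])
    rw [M.partner_partner, not_lt] at h3
    have h4 : M.partner (M'.partner j) ≠ j := fun h4 => hi.ne (by rw [← h4, M.partner_partner, h4])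
    have h5 := ih _ (lt_of_le_of_ne h3 h4) (by rwa [M.partner_partner])
    rw [M.partner_partner] at h5
    exact h4 (M'.partner_injective h5)
  have hright : ∀ j, M.partner j < j → M'.partner j = M.partner j := by
    intro j
    induction j using WellFoundedLT.induction with
    | ind j ih =>
      intro hj
      refine le_antisymm (not_lt.1 (key M M' hlt j ih hj)) (not_lt.1 ?_)
      exact key M' M (fun i => (hlt i).symm) j
        (fun j' hj' h' => (ih j' hj' ((hlt j').2 h')).symm) ((hlt j).1 hj)
  ext1
  funext i
  by_cases hi : M.partner i < i
  · exact (hright i hi).symm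
  · have hi' : i < M.partner i := lt_of_le_of_ne (not_lt.1 hi) (M.partner_ne i).symm
    have h1 := hright (M.partner i) (by rwa [M.partner_partner])
    rw [M.partner_partner] at h1
    rw [← h1, M'.partner_partner, h1]

/-- The steps `i` and `j` of a path face each other. -/
def Faces (z : Fin (2 * n) → Bool) (i j : Fin (2 * n)) : Prop :=
  i < j ∧ height z (j + 1) = height z i ∧ ∀ m : ℕ, (i : ℕ) < m → m ≤ j → height z i < height z m

theorem Faces.right_unique {z : Fin (2 * n) → Bool} {i j j' : Fin (2 * n)} (h : Faces z i j)
    (h' : Faces z i j') : j = j' := by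
  have key : ∀ {j j'}, Faces z i j → Faces z i j' → ¬ j < j' := by
    intro j j' h h' hlt
    have h1 : (i : ℕ) < j := h.1
    have := h'.2.2 (j + 1) (by omega) hlt
    rw [h.2.1] at this
    exact lt_irrefl _ this
  exact le_antisymm (not_lt.1 (key h' h)) (not_lt.1 (key h h'))

theorem Faces.left_unique {z : Fin (2 * n) → Bool} {i i' j : Fin (2 * n)} (h : Faces z i j)
    (h' : Faces z i' j) : i = i' := by
  have key : ∀ {i i'}, Faces z i j → Faces z i' j → ¬ i < i' := by
    intro i i' h h' hlt
    have := h.2.2 i' hlt h'.1.le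
    rw [← h.2.1, h'.2.1] at this
    exact lt_irrefl _ this
  exact le_antisymm (not_lt.1 (key h' h)) (not_lt.1 (key h h'))

theorem exists_faces_right {z : Fin (2 * n) → Bool} (h0 : ∀ m, 0 ≤ height z m)
    (h1 : height z (2 * n) = 0) {i : Fin (2 * n)} (hi : z i = false) : ∃ j, Faces z i j := by
  have hsi := height_succ z i
  rw [hi] at hsi
  simp only [Bool.false_eq_true, if_false] at hsi
  have hex : ∃ m, (i : ℕ) < m ∧ m < 2 * n ∧ height z (m + 1) ≤ height z i := by
    have h2 : (i : ℕ) ≠ 2 * n - 1 := by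
      intro h2
      have h3 : (i : ℕ) + 1 = 2 * n := by have := i.2; omega
      rw [h3, h1] at hsi
      have := h0 i
      omega
    refine ⟨2 * n - 1, by have := i.2; omega, by have := i.2; omega, ?_⟩
    rw [show 2 * n - 1 + 1 = 2 * n by have := i.2; omega, h1]
    exact h0 _
  classical
  obtain ⟨hm1, hm2, hm3⟩ := Nat.find_spec hex
  set m := Nat.find hex with hm
  have hmin : ∀ m' : ℕ, (i : ℕ) < m' → m' ≤ m → height z i < height z m' := by
    intro m' h2 h3
    obtain ⟨m', rfl⟩ : ∃ q, m' = q + 1 := ⟨m' - 1, by omega⟩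
    rcases (Nat.lt_succ_iff.1 h2).eq_or_lt with h4 | h4
    · rw [← h4]
      omega
    · have := Nat.find_min hex (m := m') (by omega)
      push Not at this
      exact this h4 (by omega)
  refine ⟨⟨m, hm2⟩, hm1, ?_, hmin⟩
  have hs := height_succ z ⟨m, hm2⟩
  have := hmin m hm1 le_rfl
  simp only at hs ⊢
  split_ifs at hs <;> omega

theorem exists_faces_left {z : Fin (2 * n) → Bool} (h0 : ∀ m, 0 ≤ height z m)
    {j : Fin (2 * n)} (hj : z j = true) : ∃ i, Faces z i j := by
  have hsj := height_succ z j
  rw [hj] at hsj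
  simp only [if_true] at hsj
  have hjpos : 0 < (j : ℕ) := by
    by_contra h
    rw [show (j : ℕ) = 0 by omega, height_zero] at hsj
    have := h0 (0 + 1)
    omega
  classical
  have hP : height z 0 ≤ height z (j + 1) := by
    rw [height_zero]
    exact h0 _
  set i := Nat.findGreatest (fun m => height z m ≤ height z (j + 1)) (j - 1) with hi
  have hspec : height z i ≤ height z (j + 1) :=
    Nat.findGreatest_spec (P := fun m => height z m ≤ height z (j + 1)) (Nat.zero_le _) hP
  have hle : i ≤ j - 1 := Nat.findGreatest_le _
  have hmax : ∀ m : ℕ, i < m → m ≤ j → height z (j + 1) < height z m := by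
    intro m h1 h2
    rcases h2.eq_or_lt with h3 | h3
    · rw [h3]
      omega
    · have := Nat.findGreatest_is_greatest h1 (by omega)
      exact not_le.1 this
  have hi2 : i < 2 * n := by have := j.2; omega
  have hs := height_succ z ⟨i, hi2⟩
  have h1 := hmax (i + 1) (by omega) (by omega)
  simp only at hs
  have heq : height z (j + 1) = height z i := by split_ifs at hs <;> omega
  exact ⟨⟨i, hi2⟩, by simp only [Fin.lt_def]; omega, heq, fun m h2 h3 => heq ▸ hmax m h2 h3⟩

theorem Faces.left_eq_false {z : Fin (2 * n) → Bool} {i j : Fin (2 * n)} (h : Faces z i j) :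
    z i = false := by
  have h1 := h.2.2 (i + 1) (by omega) h.1
  have h2 := height_succ z i
  by_contra hne
  rw [Bool.not_eq_false] at hne
  rw [hne] at h2
  simp only [if_true] at h2
  omega

theorem Faces.right_eq_true {z : Fin (2 * n) → Bool} {i j : Fin (2 * n)} (h : Faces z i j) :
    z j = true := by
  have h1 := h.2.2 j h.1 le_rfl
  have h2 := height_succ z j
  have h3 := h.2.1
  by_contra hne
  rw [Bool.not_eq_true] at hne
  rw [hne] at h2
  simp only [Bool.false_eq_true, if_false] at h2
  omega

/-- Every ballot word marks the right end points of a non-crossing matching. -/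
theorem exists_rightEnds_eq {z : Fin (2 * n) → Bool} (h0 : ∀ m, 0 ≤ height z m)
    (h1 : height z (2 * n) = 0) : ∃ M : NoncrossingMatching n, M.rightEnds = z := by
  have hex : ∀ i, ∃ j, if z i = true then Faces z j i else Faces z i j := by
    intro i
    cases hi : z i with
    | true => simpa using exists_faces_left h0 hi
    | false => simpa using exists_faces_right h0 h1 hi
  choose f hf using hex
  have hf1 : ∀ i, z i = true → Faces z (f i) i := fun i hi => by simpa [hi] using hf i
  have hf2 : ∀ i, z i = false → Faces z i (f i) := fun i hi => by simpa [hi] using hf i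
  have hlt : ∀ i, i < f i → z i = false := by
    intro i hi
    by_contra hne
    exact absurd (hf1 i (by simpa using hne)).1 hi.not_gt
  refine ⟨⟨f, fun i => ?_, fun i => ?_, fun i j hij hj hj' => ?_⟩, funext fun i => ?_⟩
  · cases hi : z i with
    | true => exact (hf2 _ (hf1 i hi).left_eq_false).right_unique (hf1 i hi)
    | false => exact (hf1 _ (hf2 i hi).right_eq_true).left_unique (hf2 i hi)
  · cases hi : z i with
    | true => exact (hf1 i hi).1.ne
    | false => exact (hf2 i hi).1.ne'
  · have h2 := hf2 i (hlt i (hij.trans hj))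
    have h3 := hf2 j (hlt j (hj.trans hj'))
    have h4 := h2.2.2 j hij hj.le
    have h5 := h3.2.2 (f i + 1) (by have : (j : ℕ) < f i := hj; omega) hj'
    rw [h2.2.1] at h5
    exact lt_irrefl _ (h4.trans h5)
  · simp only [rightEnds]
    cases hi : z i with
    | true => exact decide_eq_true (hf1 i hi).1
    | false => exact decide_eq_false (hf2 i hi).1.not_gt

end NoncrossingMatching

/-! ### The number of non-crossing matchings -/

/-- The Dyck word of a non-crossing matching, as a list of steps. -/
def dyckSteps (z : Fin k → Bool) : List DyckStep :=
  List.ofFn fun i => if z i = true then DyckStep.D else DyckStep.U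

theorem count_take_dyckSteps (z : Fin k → Bool) (m : ℕ) (hm : m ≤ k) :
    (((dyckSteps z).take m).count DyckStep.U : ℤ) - ((dyckSteps z).take m).count DyckStep.D =
      height z m := by
  induction m with
  | zero => simp [height_zero]
  | succ m ih =>
    have h1 : m < (dyckSteps z).length := by simpa [dyckSteps] using hm
    have h2 := height_succ z ⟨m, hm⟩
    simp only at h2
    rw [h2, ← ih (by omega), List.take_succ_eq_append_getElem h1, List.count_append,
      List.count_append]
    have h3 : (dyckSteps z)[m] = if z ⟨m, hm⟩ = true then DyckStep.D else DyckStep.U := by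
      simp [dyckSteps]
    rw [h3]
    split_ifs <;> simp <;> ring

theorem NoncrossingMatching.card_eq_catalan (n : ℕ) :
    Nat.card (NoncrossingMatching n) = catalan n := by
  have hlen : ∀ z : Fin (2 * n) → Bool, (dyckSteps z).length = 2 * n := fun z => by simp [dyckSteps]
  have htake : ∀ (M : NoncrossingMatching n) (m : ℕ),
      (((dyckSteps M.rightEnds).take m).count DyckStep.D) ≤
        ((dyckSteps M.rightEnds).take m).count DyckStep.U := by
    intro M m
    by_cases hm : m ≤ 2 * n
    · have := count_take_dyckSteps M.rightEnds m hm
      have := M.height_rightEnds_nonneg m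
      omega
    · have := M.height_rightEnds_nonneg (2 * n)
      have := count_take_dyckSteps M.rightEnds (2 * n) le_rfl
      rw [List.take_of_length_le (by rw [hlen])] at this
      rw [List.take_of_length_le (by rw [hlen]; omega)]
      omega
  have hall : ∀ M : NoncrossingMatching n, (dyckSteps M.rightEnds).count DyckStep.U =
      (dyckSteps M.rightEnds).count DyckStep.D := by
    intro M
    have := count_take_dyckSteps M.rightEnds (2 * n) le_rfl
    rw [List.take_of_length_le (by rw [hlen]), M.height_rightEnds_self] at this
    omega
  let f : NoncrossingMatching n → {p : DyckWord // p.semilength = n} := fun M =>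
    ⟨⟨dyckSteps M.rightEnds, hall M, htake M⟩, by
      have h1 := DyckWord.two_mul_semilength_eq_length
        (p := ⟨dyckSteps M.rightEnds, hall M, htake M⟩)
      simp only [hlen] at h1
      omega⟩
  have hf : Function.Bijective f := by
    constructor
    · intro M M' h
      have h1 : dyckSteps M.rightEnds = dyckSteps M'.rightEnds :=
        congrArg (fun p => p.1.toList) h
      refine rightEnds_injective (funext fun i => ?_)
      have h2 := congrFun (List.ofFn_injective h1) i
      revert h2
      cases M.rightEnds i <;> cases M'.rightEnds i <;> simp
    · rintro ⟨p, hp⟩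
      have hl : p.toList.length = 2 * n := by rw [← DyckWord.two_mul_semilength_eq_length, hp]
      let z : Fin (2 * n) → Bool := fun i =>
        decide (p.toList[i]'(by rw [hl]; exact i.2) = DyckStep.D)
      have hz : dyckSteps z = p.toList := by
        refine List.ext_getElem (by rw [hlen, hl]) fun i h1 h2 => ?_
        simp only [dyckSteps, List.getElem_ofFn, z, decide_eq_true_eq, Fin.getElem_fin]
        rcases DyckStep.dichotomy p.toList[i] with h | h <;> simp [h]
      have hh : ∀ m ≤ 2 * n, 0 ≤ height z m := by
        intro m hm
        rw [← count_take_dyckSteps z m hm, hz]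
        have := p.count_D_le_count_U m
        omega
      have hbig : ∀ m, 2 * n ≤ m → height z m = height z (2 * n) := by
        intro m hm
        refine Finset.sum_congr rfl fun i _ => ?_
        rw [if_pos i.2, if_pos (i.2.trans_le hm)]
      have hend : height z (2 * n) = 0 := by
        rw [← count_take_dyckSteps z _ le_rfl, hz, List.take_of_length_le (by rw [hl]),
          p.count_U_eq_count_D, sub_self]
      obtain ⟨M, hM⟩ := exists_rightEnds_eq (z := z) (fun m => by
        rcases le_total m (2 * n) with h | h
        · exact hh m h
        · rw [hbig m h, hend]) hend
      refine ⟨M, Subtype.ext (DyckWord.ext ?_)⟩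
      simp only [f, hM, hz]
  rw [Nat.card_congr (Equiv.ofBijective f hf), Nat.card_eq_fintype_card,
    DyckWord.card_dyckWord_semilength_eq_catalan]

end

/-! ### The highest weight vectors of non-crossing matchings -/

namespace NoncrossingMatching
variable {n : ℕ} (M : NoncrossingMatching n)

/-- The two letters of a word at the ends of every arc are different. -/
def CompatWord (z : Fin (2 * n) → Bool) : Prop := ∀ i, z (M.partner i) = !z i

instance (z : Fin (2 * n) → Bool) : Decidable (M.CompatWord z) := by
  unfold CompatWord
  infer_instance

/-- The number of arcs inside the arc with left end point `i`, itself included. -/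
def arcSize (i : Fin (2 * n)) : ℕ :=
  1 + (Finset.univ.filter fun j => i < j ∧ j < M.partner i ∧ j < M.partner j).card

/-- The exponent of `t` with which a matching contributes to a word. -/
def wordExp (z : Fin (2 * n) → Bool) : ℕ :=
  ∑ i, if z i = true ∧ i < M.partner i then M.arcSize i else 0

/-- The highest weight vector of a matching. -/
def wordVec {A : Type*} [CommRing A] (t : A) (z : Fin (2 * n) → Bool) : A :=
  if M.CompatWord z then t ^ M.wordExp z else 0

theorem compatWord_rightEnds : M.CompatWord M.rightEnds := M.rightEnds_partner

theorem partner_mem_interval {a j : Fin (2 * n)} (h1 : a < j) (h2 : j < M.partner a) :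
    a < M.partner j ∧ M.partner j < M.partner a := by
  constructor
  · by_contra h
    have hne : M.partner j ≠ a := fun h' => h2.ne (by rw [← h', M.partner_partner])
    refine M.noncrossing (M.partner j) a (lt_of_le_of_ne (not_lt.1 h) hne) ?_ ?_
    · rwa [M.partner_partner]
    · rwa [M.partner_partner]
  · by_contra h
    have hne : M.partner j ≠ M.partner a := fun h' => h1.ne' (M.partner_injective h')
    exact M.noncrossing a j h1 h2 (lt_of_le_of_ne (not_lt.1 h) hne.symm)

theorem prod_interval {A : Type*} [CommRing A] (t : A) {z : Fin (2 * n) → Bool}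
    {a : Fin (2 * n)} (hz : ∀ j, a < j → j < M.partner a → z (M.partner j) = !z j) :
    ∏ j with a < j ∧ j < M.partner a, letterFactor t (z j) =
      t ^ (Finset.univ.filter fun j => a < j ∧ j < M.partner a ∧ j < M.partner j).card := by
  rw [← Finset.prod_filter_mul_prod_filter_not _ fun j => j < M.partner j]
  have h1 : ∏ j ∈ (Finset.univ.filter fun j => a < j ∧ j < M.partner a) with ¬ j < M.partner j,
      letterFactor t (z j) =
      ∏ j ∈ (Finset.univ.filter fun j => a < j ∧ j < M.partner a) with j < M.partner j,
        letterFactor t (z (M.partner j)) := by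
    refine Finset.prod_nbij' M.partner M.partner ?_ ?_ ?_ ?_ ?_
    · intro j hj
      simp only [Finset.mem_filter, Finset.mem_univ, true_and, M.partner_partner] at hj ⊢
      exact ⟨M.partner_mem_interval hj.1.1 hj.1.2,
        lt_of_le_of_ne (not_lt.1 hj.2) (M.partner_ne j)⟩
    · intro j hj
      simp only [Finset.mem_filter, Finset.mem_univ, true_and, M.partner_partner] at hj ⊢
      exact ⟨M.partner_mem_interval hj.1.1 hj.1.2, hj.2.not_gt⟩
    · exact fun j _ => M.partner_partner j
    · exact fun j _ => M.partner_partner j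
    · exact fun j _ => by rw [M.partner_partner]
  rw [h1, ← Finset.prod_mul_distrib, Finset.filter_filter]
  simp only [and_assoc]
  refine Finset.prod_eq_pow_card fun j hj => ?_
  simp only [Finset.mem_filter, Finset.mem_univ, true_and] at hj
  rw [hz j hj.1 hj.2.1]
  cases z j <;> simp [letterFactor]

theorem wordExp_update {z : Fin (2 * n) → Bool} {a : Fin (2 * n)} (ha : a < M.partner a)
    (hza : z a = true) (hzb : z (M.partner a) = true) :
    M.wordExp (Function.update z (M.partner a) false) =
      M.wordExp (Function.update z a false) + M.arcSize a := by
  have h : ∀ i, (if Function.update z (M.partner a) false i = true ∧ i < M.partner i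
        then M.arcSize i else 0) =
      (if Function.update z a false i = true ∧ i < M.partner i then M.arcSize i else 0) +
        if i = a then M.arcSize i else 0 := by
    intro i
    by_cases h1 : i = a
    · subst h1
      simp [ha.ne, hza, ha]
    · by_cases h2 : i = M.partner a
      · subst h2
        simp [M.partner_partner, ha.not_gt, ha.ne']
      · simp [h1, h2]
  simp only [wordExp, h, Finset.sum_add_distrib, Finset.sum_ite_eq', Finset.mem_univ, if_true]

theorem raiseFun_wordVec_pair {A : Type*} [CommRing A] (t : A) {z : Fin (2 * n) → Bool}
    {a : Fin (2 * n)} (ha : a < M.partner a) (hza : z a = true) (hzb : z (M.partner a) = true)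
    (hz : ∀ j, j ≠ a → j ≠ M.partner a → z (M.partner j) = !z j) :
    raiseFun t (M.wordVec t) z = 0 := by
  set b := M.partner a with hb
  have hba : M.partner b = a := M.partner_partner a
  have hca : M.CompatWord (Function.update z a false) := by
    intro i
    by_cases h1 : i = a
    · subst h1
      simp [← hb, ha.ne', hzb]
    · by_cases h2 : i = b
      · subst h2
        simp [hba, ha.ne', hzb]
      · have h3 : M.partner i ≠ a := fun h3 => h2 (by rw [hb, ← h3, M.partner_partner])
        simp [h1, h3, hz i h1 h2]
  have hcb : M.CompatWord (Function.update z b false) := by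
    intro i
    by_cases h1 : i = a
    · subst h1
      simp [← hb, ha.ne, hza]
    · by_cases h2 : i = b
      · subst h2
        simp [hba, ha.ne, hza]
      · have h3 : M.partner i ≠ b := fun h3 => h1 (M.partner_injective (h3.trans hb))
        simp [h2, h3, hz i h1 h2]
  have hother : ∀ i, i ≠ a → i ≠ b → ¬ M.CompatWord (Function.update z i false) := by
    intro i h1 h2 h3
    have := h3 a
    rw [← hb, Function.update_of_ne h2.symm, Function.update_of_ne h1.symm, hza, hzb] at this
    exact absurd this (by simp)
  have hfac : ∀ i j : Fin (2 * n), i = a →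
      (if i < j then letterFactor t (z j) else 1) =
        (if b < j then letterFactor t (z j) else 1) * ((if j = b then letterFactor t (z j) else 1) *
          if a < j ∧ j < b then letterFactor t (z j) else 1) := by
    rintro i j rfl
    rcases lt_trichotomy j b with h | h | h
    · simp [h, h.ne, h.not_gt]
    · subst h
      simp [ha]
    · simp [h, h.ne', h.not_gt, ha.trans h]
  rw [raiseFun, Finset.sum_eq_add a b ha.ne]
  · rw [if_pos hza, if_pos hzb, wordVec, wordVec, if_pos hca, if_pos hcb, hb,
      M.wordExp_update ha hza hzb, ← hb]
    simp only [hfac a _ rfl, Finset.prod_mul_distrib, Finset.prod_ite_eq', Finset.mem_univ, if_true]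
    rw [← Finset.prod_filter (fun j => a < j ∧ j < b),
      M.prod_interval t fun j h1 h2 => hz j h1.ne' h2.ne, hzb, letterFactor, if_pos rfl,
      arcSize, pow_add, pow_add, ← hb]
    ring
  · intro i _ hi
    rw [wordVec, if_neg (hother i hi.1 hi.2), mul_zero, ite_self]
  · simp
  · simp

theorem raiseFun_wordVec {A : Type*} [CommRing A] (t : A) : raiseFun t (M.wordVec t) = 0 := by
  funext z
  by_cases h : ∃ i, z i = true ∧ M.CompatWord (Function.update z i false)
  · obtain ⟨i, hi, hc⟩ := h
    have hp : z (M.partner i) = true := by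
      have := hc i
      rw [Function.update_of_ne (M.partner_ne i)] at this
      simpa using this
    have hz : ∀ j, j ≠ i → j ≠ M.partner i → z (M.partner j) = !z j := by
      intro j h1 h2
      have := hc j
      have h3 : M.partner j ≠ i := fun h3 => h2 (by rw [← h3, M.partner_partner])
      rwa [Function.update_of_ne h1, Function.update_of_ne h3] at this
    rcases lt_or_gt_of_ne (M.partner_ne i) with h | h
    · exact M.raiseFun_wordVec_pair t (a := M.partner i) (by rwa [M.partner_partner]) hp
        (by rwa [M.partner_partner]) fun j h1 h2 => hz j (by rwa [M.partner_partner] at h2) h1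
    · exact M.raiseFun_wordVec_pair t h hi hp hz
  · push Not at h
    refine Finset.sum_eq_zero fun i _ => ?_
    split_ifs with hi
    · rw [wordVec, if_neg (h i hi), mul_zero]
    · rfl

/-- The sum of the positions of the letters `true`. -/
def _root_.positionSum {k : ℕ} (z : Fin k → Bool) : ℕ := ∑ i, if z i = true then (i : ℕ) else 0

theorem two_mul_positionSum {z : Fin (2 * n) → Bool} (hz : M.CompatWord z) :
    2 * positionSum z = ∑ i, if z i = true then (i : ℕ) else M.partner i := by
  have h := Equiv.sum_comp M.partnerEquiv fun i => if z i = true then (i : ℕ) else 0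
  rw [positionSum, two_mul]
  nth_rw 2 [← h]
  rw [← Finset.sum_add_distrib]
  refine Finset.sum_congr rfl fun i _ => ?_
  have : z (M.partnerEquiv i) = !z i := hz i
  rw [this]
  cases z i <;> simp [partnerEquiv]

theorem positionSum_le {z : Fin (2 * n) → Bool} (hz : M.CompatWord z) :
    positionSum z ≤ positionSum M.rightEnds ∧
      (positionSum z = positionSum M.rightEnds → z = M.rightEnds) := by
  have h1 := M.two_mul_positionSum hz
  have h2 := M.two_mul_positionSum M.compatWord_rightEnds
  have hle : ∀ i ∈ Finset.univ, (if z i = true then (i : ℕ) else M.partner i) ≤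
      if M.rightEnds i = true then (i : ℕ) else M.partner i := by
    intro i _
    simp only [rightEnds, decide_eq_true_eq, Fin.lt_def]
    split_ifs <;> omega
  have hsum := Finset.sum_le_sum hle
  refine ⟨by omega, fun heq => funext fun i => ?_⟩
  have h3 := (Finset.sum_eq_sum_iff_of_le hle).1 (by omega) i (Finset.mem_univ i)
  have hne := Fin.val_ne_of_ne (M.partner_ne i)
  simp only [rightEnds, decide_eq_true_eq, Fin.lt_def] at h3 ⊢
  cases hzi : z i <;> rw [hzi] at h3
  · rw [eq_comm, decide_eq_false_iff_not]
    intro hlt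
    simp [hlt] at h3
    omega
  · rw [eq_comm, decide_eq_true_eq]
    by_contra hlt
    simp [hlt] at h3
    omega

end NoncrossingMatching

/-! ### Expansion of the LLT polynomials -/

section
variable {n : ℕ}

theorem height_of_le {k : ℕ} (z : Fin k → Bool) {m : ℕ} (hm : k ≤ m) :
    height z m = height z k := by
  refine Finset.sum_congr rfl fun i _ => ?_
  rw [if_pos i.2, if_pos (i.2.trans_le hm)]

theorem trueCount_update {k : ℕ} {z : Fin k → Bool} {i : Fin k} (hi : z i = true) :
    trueCount (Function.update z i false) + 1 = trueCount z := by
  have h : ∀ j, (z j).toNat = (Function.update z i false j).toNat + if j = i then 1 else 0 := by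
    intro j
    by_cases hj : j = i
    · subst hj
      simp [hi]
    · simp [hj]
  rw [trueCount, trueCount, Finset.sum_congr rfl fun j _ => h j]
  simp [Finset.sum_add_distrib]

namespace NoncrossingMatching

theorem trueCount_of_compatWord {M : NoncrossingMatching n} {z : Fin (2 * n) → Bool}
    (hz : M.CompatWord z) : trueCount z = n := by
  have h : trueCount z + trueCount z = 2 * n := by
    have h1 := Equiv.sum_comp M.partnerEquiv fun i => (z i).toNat
    rw [trueCount]
    nth_rw 2 [← h1]
    rw [← Finset.sum_add_distrib]
    have h2 : ∀ i, (z i).toNat + (z (M.partnerEquiv i)).toNat = 1 := by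
      intro i
      rw [show z (M.partnerEquiv i) = !z i from hz i]
      cases z i <;> rfl
    simp [h2]
  omega

instance : Finite (NoncrossingMatching n) := Finite.of_injective _ rightEnds_injective

theorem map_wordVec {A B : Type*} [CommRing A] [CommRing B] (φ : A →+* B)
    (M : NoncrossingMatching n) (t : A) (z : Fin (2 * n) → Bool) :
    φ (M.wordVec t z) = M.wordVec (φ t) z := by
  simp only [wordVec]
  split_ifs <;> simp

/-- The values of the vectors of all matchings on ballot words form an invertible matrix. -/
theorem isUnit_det_wordVec {ι : Type*} [Fintype ι] [DecidableEq ι] {A : Type*} [CommRing A]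
    {t : A} (ht : IsUnit t) {M : ι → NoncrossingMatching n} (hM : Function.Injective M) :
    IsUnit (Matrix.of fun i j => (M j).wordVec t (M i).rightEnds).det := by
  have hne : ∀ i j, (M j).wordVec t (M i).rightEnds ≠ 0 → (M j).CompatWord (M i).rightEnds :=
    fun i j h => by
      by_contra h'
      exact h (if_neg h')
  have htri : (Matrix.of fun i j => (M j).wordVec t (M i).rightEnds).BlockTriangular
      fun i => positionSum (M i).rightEnds := by
    intro i j hij
    by_contra h
    exact absurd ((M j).positionSum_le (hne i j h)).1 (not_le.2 hij)
  rw [htri.det, IsUnit.prod_iff]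
  intro a _
  have hdiag : (Matrix.of fun i j => (M j).wordVec t (M i).rightEnds).toSquareBlock
      (fun i => positionSum (M i).rightEnds) a =
      Matrix.diagonal fun i => (M i.1).wordVec t (M i.1).rightEnds := by
    ext i j
    rw [Matrix.diagonal_apply]
    split_ifs with h
    · rw [h]
      rfl
    · by_contra h'
      have h1 := ((M j).positionSum_le (hne i j h')).2 (i.2.trans j.2.symm)
      exact h (Subtype.ext (hM (rightEnds_injective h1)))
  rw [hdiag, Matrix.det_diagonal, IsUnit.prod_iff]
  intro i _
  rw [wordVec, if_pos (compatWord_rightEnds _)]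
  exact ht.pow _

end NoncrossingMatching

/-- A function on words that is annihilated by the raising operator and vanishes at the right end
points of all matchings is zero. -/
theorem eq_zero_of_rightEnds {A : Type*} [CommRing A] [IsDomain A] (t : A) (φ : A →+* ℤ)
    (hφ : φ t = 1) {f : (Fin (2 * n) → Bool) → A} (hf : SupportedAt f 0 n)
    (h : raiseFun t f = 0) (hM : ∀ M : NoncrossingMatching n, f M.rightEnds = 0) : f = 0 := by
  refine eq_zero_of_suffixBallot t φ hφ hf h fun z hz => ?_
  by_cases hc : trueCount z = n
  · have hend : height z (2 * n) = 0 := by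
      rw [height_self, hc]
      push_cast
      ring
    obtain ⟨M, rfl⟩ := NoncrossingMatching.exists_rightEnds_eq (z := z) (fun m => by
      rcases le_total m (2 * n) with h | h
      · exact hend ▸ hz.height_le h
      · rw [height_of_le z h, hend]) hend
    exact hM M
  · exact hf z (by simpa using hc)

theorem raiseFun_restrict {A : Type*} [CommRing A] (t : A) {k : ℕ} {f : (Fin k → Bool) → A}
    (h : raiseFun t f = 0) (p : ℕ) :
    raiseFun t (fun z => if trueCount z = p then f z else 0) = 0 := by
  funext z
  by_cases hz : trueCount z = p + 1
  · rw [← h]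
    refine Finset.sum_congr rfl fun i _ => if_ctx_congr Iff.rfl (fun hi => ?_) fun _ => rfl
    have := trueCount_update hi
    simp only [if_pos (show trueCount (Function.update z i false) = p by omega)]
  · refine Finset.sum_eq_zero fun i _ => ?_
    by_cases hi : z i = true
    · have := trueCount_update hi
      simp only [if_neg (show ¬ trueCount (Function.update z i false) = p by omega), mul_zero,
        ite_self]
    · rw [if_neg hi]

theorem raiseFun_sum {A : Type*} [CommRing A] (t : A) {k : ℕ} {ι : Type*} (s : Finset ι)
    (f : ι → (Fin k → Bool) → A) : raiseFun t (∑ i ∈ s, f i) = ∑ i ∈ s, raiseFun t (f i) := by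
  classical
  induction s using Finset.induction_on with
  | empty => simp [raiseFun_zero]
  | insert a s ha ih => rw [Finset.sum_insert ha, Finset.sum_insert ha, raiseFun_add, ih]

/-- The half subset of the letters `true` of a word. -/
def HalfSubset.ofWord {z : Fin (2 * n) → Bool} (hz : trueCount z = n) : HalfSubset n :=
  ⟨Finset.univ.filter fun i => z i = true, by
    refine (Finset.card_filter _ _).trans (Eq.trans ?_ hz)
    refine Finset.sum_congr rfl fun i _ => ?_
    cases z i <;> simp⟩

/-- The word of a half subset. -/
def HalfSubset.word (S : HalfSubset n) (i : Fin (2 * n)) : Bool := decide (i ∈ S.1)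

theorem HalfSubset.word_ofWord {z : Fin (2 * n) → Bool} (hz : trueCount z = n) :
    (HalfSubset.ofWord hz).word = z := by
  funext i
  simp [HalfSubset.word, HalfSubset.ofWord]

theorem HalfSubset.trueCount_word (S : HalfSubset n) : trueCount S.word = n := by
  have h : ∀ i, (S.word i).toNat = if i ∈ S.1 then 1 else 0 := fun i => by
    by_cases hi : i ∈ S.1 <;> simp [HalfSubset.word, hi]
  simp only [trueCount, h, Finset.sum_boole]
  simp [S.2]

theorem compatible_iff (M : NoncrossingMatching n) (S : HalfSubset n) :
    M.Compatible S ↔ M.CompatWord S.word := by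
  refine forall_congr' fun i => ?_
  by_cases h1 : M.partner i ∈ S.1 <;> by_cases h2 : i ∈ S.1 <;> simp [HalfSubset.word, h1, h2]

/-- Every finite matrix of Laurent polynomials becomes a matrix of polynomials after
multiplication by a power of the variable. -/
theorem exists_clear_denominators {ι κ : Type*} [Fintype ι] [Fintype κ]
    (B : Matrix ι κ ℤ[T;T⁻¹]) : ∃ (d : ℕ) (B' : Matrix ι κ ℤ[X]),
      ∀ i j, Polynomial.toLaurent (B' i j) = B i j * LaurentPolynomial.T d := by
  choose e p hp using fun q : ι × κ => LaurentPolynomial.exists_T_pow (B q.1 q.2)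
  refine ⟨∑ q, e q, Matrix.of fun i j => p (i, j) * Polynomial.X ^ (∑ q, e q - e (i, j)),
    fun i j => ?_⟩
  have hle : e (i, j) ≤ ∑ q, e q := Finset.single_le_sum (f := e) (fun _ _ => Nat.zero_le _)
    (Finset.mem_univ (i, j))
  rw [Matrix.of_apply, map_mul, hp, Polynomial.toLaurent_X_pow, mul_assoc,
    ← LaurentPolynomial.T_add]
  congr 2
  push_cast [hle]
  ring

open FixedPartition in
/-- The expansion of the LLT polynomials in terms of the vectors of the matchings. -/
theorem toLaurentCoeffs_LLT_eq_sum {β : Fin (2 * n) → ℕ} (hβ : StrictAnti β)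
    {ι : Type*} [Fintype ι] [DecidableEq ι] (M : ι ≃ NoncrossingMatching n) (N : ℕ)
    (g : ι → MvPolynomial (Fin N) ℤ[T;T⁻¹])
    (hg : ∀ i, ∑ j, MvPolynomial.C ((M j).wordVec (LaurentPolynomial.T 1) (M i).rightEnds) * g j =
      toLaurentCoeffs N (LLT N (famPart β hβ (HalfSubset.ofWord
        ((M i).trueCount_of_compatWord (M i).compatWord_rightEnds)))
        (famPart β hβ (HalfSubset.ofWord
          ((M i).trueCount_of_compatWord (M i).compatWord_rightEnds)).compl)))
    (S : HalfSubset n) :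
    toLaurentCoeffs N (LLT N (famPart β hβ S) (famPart β hβ S.compl)) =
      ∑ j, MvPolynomial.C ((M j).wordVec (LaurentPolynomial.T 1) S.word) * g j := by
  set K := ∑ i, β i + 1
  have hK : ∀ i, β i < K := fun i => Nat.lt_succ_of_le
    (Finset.single_le_sum (f := β) (fun _ _ => Nat.zero_le _) (Finset.mem_univ i))
  have hfam : ∀ (S : HalfSubset n) i, (famPart β hβ S).pos i < K := fun S i => by
    rw [famPart_pos]
    exact hK _
  set t : MvPolynomial (Fin N) ℤ[T;T⁻¹] := MvPolynomial.C (LaurentPolynomial.T 1) with ht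
  set F : (Fin (2 * n) → Bool) → MvPolynomial (Fin N) ℤ[T;T⁻¹] := fun z =>
    partitionFun t MvPolynomial.X
      (pairState K (FixedPartition.zero n) (FixedPartition.zero n)) (wordState K β z)
  have hF : ∀ S : HalfSubset n,
      toLaurentCoeffs N (LLT N (famPart β hβ S) (famPart β hβ S.compl)) = F S.word := by
    intro S
    rw [LLT_eq_partitionFun N (hfam S) (hfam S.compl), map_partitionFun, pairState_famPart]
    have h1 : toLaurentCoeffs N (MvPolynomial.C Polynomial.X) = t := by
      rw [toLaurentCoeffs, MvPolynomial.map_C, Polynomial.toLaurent_X]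
    have h2 : toLaurentCoeffs N ∘ MvPolynomial.X = MvPolynomial.X := by
      funext i
      simp [toLaurentCoeffs]
    rw [h1, h2]
    rfl
  set D : (Fin (2 * n) → Bool) → MvPolynomial (Fin N) ℤ[T;T⁻¹] :=
    (fun z => if trueCount z = n then F z else 0) + ∑ j, (-g j) • (M j).wordVec t with hD
  have hCvec : ∀ j z, MvPolynomial.C ((M j).wordVec (LaurentPolynomial.T 1) z) =
      (M j).wordVec t z := fun j z => NoncrossingMatching.map_wordVec MvPolynomial.C _ _ _
  have hDapply : ∀ z, trueCount z = n →
      D z = F z - ∑ j, MvPolynomial.C ((M j).wordVec (LaurentPolynomial.T 1) z) * g j := by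
    intro z hz
    simp only [hD, Pi.add_apply, if_pos hz, Finset.sum_apply, Pi.smul_apply, smul_eq_mul, hCvec,
      sub_eq_add_neg, ← Finset.sum_neg_distrib]
    congr 1
    refine Finset.sum_congr rfl fun j _ => ?_
    ring
  have hD0 : D = 0 := by
    refine eq_zero_of_rightEnds t
      (MvPolynomial.eval₂Hom (LaurentPolynomial.eval₂ (RingHom.id ℤ) 1) 0) ?_ ?_ ?_ fun M' => ?_
    · rw [ht, MvPolynomial.coe_eval₂Hom, MvPolynomial.eval₂_C]
      simp
    · intro z hz
      rw [add_zero] at hz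
      simp only [hD, Pi.add_apply, if_neg hz, Finset.sum_apply, Pi.smul_apply, smul_eq_mul,
        zero_add]
      refine Finset.sum_eq_zero fun j _ => ?_
      rw [NoncrossingMatching.wordVec, if_neg, mul_zero]
      exact fun h => hz (NoncrossingMatching.trueCount_of_compatWord h)
    · rw [hD, raiseFun_add, raiseFun_sum, raiseFun_restrict t (funext fun z =>
        raiseFun_partitionFun hβ t _ hK (colorBalanced_pairState K _) z), zero_add]
      refine Finset.sum_eq_zero fun j _ => ?_
      rw [raiseFun_smul, NoncrossingMatching.raiseFun_wordVec, smul_zero]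
    · obtain ⟨i, rfl⟩ := M.surjective M'
      have hc := (M i).trueCount_of_compatWord (M i).compatWord_rightEnds
      rw [hDapply _ hc, hg, hF, HalfSubset.word_ofWord, sub_self]
  have h := hDapply S.word S.trueCount_word
  rw [hD0, Pi.zero_apply, eq_comm, sub_eq_zero] at h
  rw [hF, h]

end

theorem mainTheorem2 (n : ℕ) (β : Fin (2 * n) → ℕ) (hβ : StrictAnti β) :
    ∃ (M : Fin (catalan n) ≃ NoncrossingMatching n)
      (e : Fin (catalan n) → HalfSubset n → ℤ),
      ∀ N : ℕ, ∃ g : Fin (catalan n) → MvPolynomial (Fin N) (Polynomial ℤ),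
        (∀ j, (g j).IsSymmetric) ∧
        ∀ S : HalfSubset n,
          toLaurentCoeffs N (LLT N (famPart β hβ S) (famPart β hβ S.compl)) =
            ∑ j : Fin (catalan n) with (M j).Compatible S,
              MvPolynomial.C (LaurentPolynomial.T (e j S)) * toLaurentCoeffs N (g j) := by
  obtain ⟨M⟩ : Nonempty (Fin (catalan n) ≃ NoncrossingMatching n) :=
    ⟨(Finite.equivFinOfCardEq (NoncrossingMatching.card_eq_catalan n)).symm⟩
  set B : Matrix (Fin (catalan n)) (Fin (catalan n)) ℤ[T;T⁻¹] :=
    Matrix.of fun i j => (M j).wordVec (LaurentPolynomial.T 1) (M i).rightEnds with hB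
  have hdet : IsUnit B.det :=
    NoncrossingMatching.isUnit_det_wordVec (LaurentPolynomial.isUnit_T 1) M.injective
  obtain ⟨d, C, hC⟩ := exists_clear_denominators B⁻¹
  refine ⟨M, fun j S => (M j).wordExp S.word - d, fun N => ?_⟩
  set P : Fin (catalan n) → MvPolynomial (Fin N) ℤ[X] := fun i =>
    LLT N (famPart β hβ (HalfSubset.ofWord
        ((M i).trueCount_of_compatWord (M i).compatWord_rightEnds)))
      (famPart β hβ (HalfSubset.ofWord
        ((M i).trueCount_of_compatWord (M i).compatWord_rightEnds)).compl) with hP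
  refine ⟨fun j => ∑ i, MvPolynomial.C (C j i) * P i, fun j => ?_, fun S => ?_⟩
  · rw [← MvPolynomial.mem_symmetricSubalgebra]
    refine Subalgebra.sum_mem _ fun i _ => ?_
    rw [MvPolynomial.mem_symmetricSubalgebra]
    exact (MvPolynomial.IsSymmetric.C _).mul (LLT_isSymmetric N _ _)
  · have hg : ∀ i, ∑ j, MvPolynomial.C (B i j) *
        ∑ k, MvPolynomial.C (B⁻¹ j k) * toLaurentCoeffs N (P k) = toLaurentCoeffs N (P i) := by
      intro i
      have h1 : ∀ k, ∑ j, B i j * B⁻¹ j k = if i = k then 1 else 0 := fun k => by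
        rw [← Matrix.mul_apply, Matrix.mul_nonsing_inv B hdet, Matrix.one_apply]
      simp only [Finset.mul_sum, ← mul_assoc, ← MvPolynomial.C_mul]
      rw [Finset.sum_comm]
      simp only [← Finset.sum_mul, ← map_sum, h1]
      simp
    rw [toLaurentCoeffs_LLT_eq_sum hβ M N _ hg S, Finset.sum_filter]
    refine Finset.sum_congr rfl fun j _ => ?_
    simp only [compatible_iff, NoncrossingMatching.wordVec]
    split_ifs with hc
    · have h2 : ∀ k, toLaurentCoeffs N (MvPolynomial.C (C j k)) =
          MvPolynomial.C (B⁻¹ j k) * MvPolynomial.C (LaurentPolynomial.T d) := fun k => by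
        rw [toLaurentCoeffs, MvPolynomial.map_C, hC, MvPolynomial.C_mul]
      have h3 : (MvPolynomial.C (LaurentPolynomial.T 1 ^ (M j).wordExp S.word) :
          MvPolynomial (Fin N) ℤ[T;T⁻¹]) =
          MvPolynomial.C (LaurentPolynomial.T ((M j).wordExp S.word - d)) *
            MvPolynomial.C (LaurentPolynomial.T d) := by
        rw [← MvPolynomial.C_mul, ← LaurentPolynomial.T_add, LaurentPolynomial.T_pow]
        congr 2
        ring
      rw [map_sum, h3, mul_assoc]
      congr 1
      rw [Finset.mul_sum]
      refine Finset.sum_congr rfl fun k _ => ?_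
      rw [map_mul, h2]
      ring
    · rw [map_zero, zero_mul]
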